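/- Let $d\ge 2$, let $\mathbb N=\{1,2,\dots\}$, and order $\mathbb N^d$ coordinatewise. Let $\alpha_1\le\alpha_2\le\dots\le\alpha_d$ be real numbers with $\alpha_1\ge\frac12$, put $p=\max\{k:\alpha_k=\alpha_1\}$, and for $\mathbf n=(n_1,\dots,n_d)\in\mathbb N^d$ write $|\mathbf n|=n_1\cdots n_d$ and $|\mathbf n^{\boldsymbol\alpha}|=n_1^{\alpha_1}\cdots n_d^{\alpha_d}$. Let $r\ge 1$ with $\alpha_1 r\ge 1$. Let $\{X_{\mathbf n},\ \mathbf n\in\mathbb N^d\}$ be integrable random variables on a probability space with $EX_{\mathbf n}=0$, and $S_{\mathbf n}=\sum_{\mathbf k\le\mathbf n}X_{\mathbf k}$. Suppose that they are negatively dependent: for every finite $J\subset\mathbb N^d$ and all real $x_{\mathbf j}$, $\mathbf j\in J$, $$P\Big(\bigcap_{\mathbf j\in J}\{X_{\mathbf j}\le x_{\mathbf j}\}\Big)\le\prod_{\mathbf j\in J}P(X_{\mathbf j}\le x_{\mathbf j}),\qquad P\Big(\bigcap_{\mathbf j\in J}\{X_{\mathbf j}> x_{\mathbf j}\}\Big)\le\prod_{\mathbf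 j\in J}P(X_{\mathbf j}> x_{\mathbf j}).$$ Suppose also that they are weakly mean bounded by a random variable $\xi$ (possibly defined on a different probability space): there are $\kappa_1,\kappa_2>0$, $\mathbf n_0\in\mathbb N^d$ and $x_0>0$ such that for all $x>x_0$ and all $\mathbf n\ge\mathbf n_0$ $$\kappa_2P(|\xi|>x)\le\frac1{|\mathbf n|}\sum_{\mathbf k\le\mathbf n}P(|X_{\mathbf k}|>x)\le\kappa_1P(|\xi|>x).$$ (i) If $\alpha_1>\frac12$ and $$E\big[|\xi|^r(\log_+|\xi|)^{p-1}\big]<\infty,\tag{1}$$ then $$\sum_{\mathbf n\in\mathbb N^d}|\mathbf n|^{\alpha_1r-2}P\big(|S_{\mathbf n}|>|\mathbf n^{\boldsymbol\alpha}|\varepsilon\big)<\infty\quad\text{for all }\varepsilon>0.$$ (ii) Conversely (also when $\alpha_1=\frac12$), if $$\sum_{\mathbf n\in\mathbb N^d}|\mathbf n|^{\alpha_1r-2}P\Big(\max_{\mathbf k\le\mathbf n}|S_{\mathbf k}|>|\mathbf n^{\boldsymbol\alpha}|\varepsilon\Big)<\infty\quad\text{for all }\varepsilon>0,$$ then (1)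 holds. Here $\log_+x=\max(\log x,0)$ for $x>0$, $\log_+0=0$, and $(\log_+|\xi|)^{0}=1$. -/

import Mathlib

open MeasureTheory

namespace NDField

/-- The lattice of `d`-tuples of positive integers, with the coordinatewise order. -/
abbrev Lattice (d : ℕ) : Type := Fin d → ℕ+

/-- `|n| = n₁ ⋯ n_d`. -/
noncomputable def size {d : ℕ} (n : Lattice d) : ℝ := ∏ i, ((n i : ℕ) : ℝ)

/-- `|n^α| = n₁^α₁ ⋯ n_d^α_d`. -/
noncomputable def sizePow {d : ℕ} (α : Fin d → ℝ) (n : Lattice d) : ℝ :=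
  ∏ i, ((n i : ℕ) : ℝ) ^ α i

/-- `p = max {k : α_k = a}`, where the coordinates are numbered `1, …, d`. -/
noncomputable def lastIndex {d : ℕ} (α : Fin d → ℝ) (a : ℝ) : ℕ :=
  (Finset.univ.filter fun k : Fin d => α k = a).sup fun k => (k : ℕ) + 1

/-- The partial sum `S_n = ∑_{k ≤ n} X_k`. -/
noncomputable def partialSum {d : ℕ} {Ω : Type*} (X : Lattice d → Ω → ℝ) (n : Lattice d) (ω : Ω) :
    ℝ :=
  ∑ k ∈ Finset.Icc 1 n, X k ω

/-- `max_{k ≤ n} |S_k|`. -/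
noncomputable def maxAbsPartialSum {d : ℕ} {Ω : Type*} (X : Lattice d → Ω → ℝ) (n : Lattice d)
    (ω : Ω) : ℝ :=
  (Finset.Icc 1 n).sup' (Finset.nonempty_Icc.2 fun i => PNat.one_le (n i))
    fun k => |partialSum X k ω|

/-- Negative dependence of a (possibly infinite) family of random variables: every finite subfamily
is negatively dependent, that is, both orthant inequalities hold. -/
def NegDependent {ι Ω : Type*} [MeasurableSpace Ω] (X : ι → Ω → ℝ) (P : Measure Ω) : Prop :=
  ∀ (s : Finset ι) (x : ι → ℝ),
    P.real (⋂ j ∈ s, {ω | X j ω ≤ x j}) ≤ ∏ j ∈ s, P.real {ω | X j ω ≤ x j} ∧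
    P.real (⋂ j ∈ s, {ω | x j < X j ω}) ≤ ∏ j ∈ s, P.real {ω | x j < X j ω}

/-- The random field `X` is weakly mean bounded by the random variable `ξ`, which may live on a
different probability space. -/
def WeaklyMeanBounded {d : ℕ} {Ω Ω' : Type*} [MeasurableSpace Ω] [MeasurableSpace Ω']
    (X : Lattice d → Ω → ℝ) (P : Measure Ω) (ξ : Ω' → ℝ) (Q : Measure Ω') : Prop :=
  ∃ κ₁ κ₂ : ℝ, 0 < κ₁ ∧ 0 < κ₂ ∧ ∃ (n₀ : Lattice d) (x₀ : ℝ), 0 < x₀ ∧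
    ∀ x : ℝ, x₀ < x → ∀ n : Lattice d, n₀ ≤ n →
      κ₂ * Q.real {ω | x < |ξ ω|} ≤
          1 / size n * ∑ k ∈ Finset.Icc 1 n, P.real {ω | x < |X k ω|} ∧
        1 / size n * ∑ k ∈ Finset.Icc 1 n, P.real {ω | x < |X k ω|} ≤
          κ₁ * Q.real {ω | x < |ξ ω|}

end NDField

namespace NDField

/-! Both directions rest on one deterministic count: for large `z`, the sum of `|n|^(α₁ r - 1)` over
the lattice points with `|n^α| < z` has the exact order `z^r (log z)^(p-1)`. One coordinate with
exponent `α₁` produces the power `z^r`; every further coordinate with exponent `α₁` contributes a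
harmonic sum, hence one logarithm; a coordinate with a larger exponent contributes a convergent
series. By Tonelli, condition (1) is therefore the convergence of `∑ |n|^(α₁ r - 1) Q(|ξ| > c
|n^α|)`. The upper bound (`tsum_lattice_min_le`) is proved for the smoother weight `min(1,
z/|n^α|)^q` with `q > r`, which also handles truncated moments; the lower bound is
`le_tsum_lattice_lt`.

Direct part. Clipping is monotone, so it preserves the orthant inequalities, and the exponential
moments of the clipped variables are submultiplicative. A Bernstein argument gives the Fuk–Nagaev
inequality `P(|S_n| > x) ≤ ∑ P(|X_k| > y) + 2e (B/y²)^(x/(2y))`, used with `x = ε|n^α|` and `y =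
x/N`. Mean boundedness replaces sums over `k ≤ n` by `|n|` times a quantity of one variable `η =
max(|ξ|, x₁)`. The first term is then the tail series of `η`. For `r < 2` and `N = 2` the second is
a series of truncated second moments of `η`; for `r ≥ 2` the variance is bounded, and `α₁ > 1/2`
lets a large `N` make the second term negligible.

Converse part. Each `X_k` is an alternating sum of at most `2^d` partial sums, so a large `|X_k|`
forces a large maximum. Negative dependence bounds the probability of some large `|X_k|` below by `½
min(1, ½ ∑ P(|X_k| > t))`. Summation over the boxes `[n, 2n]` shows that the minimum is not attained
by `1` outside a finite set of `n` (among `n ≥ n₀`), so the tail series of `|ξ|` converges, and the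
lower count gives (1). -/

lemma size_cons {k : ℕ} (m : ℕ+) (n : Lattice k) :
    size (Fin.cons m n : Lattice (k + 1)) = (m : ℕ) * size n := by
  simp [size, Fin.prod_univ_succ]

lemma sizePow_cons {k : ℕ} (α : Fin (k + 1) → ℝ) (m : ℕ+) (n : Lattice k) :
    sizePow α (Fin.cons m n : Lattice (k + 1)) =
      ((m : ℕ) : ℝ) ^ α 0 * sizePow (fun i => α i.succ) n := by
  simp [sizePow, Fin.prod_univ_succ]

lemma tsum_lattice_succ {k : ℕ} (f : Lattice (k + 1) → ENNReal) :
    ∑' n, f n = ∑' (m : ℕ+) (n : Lattice k), f (Fin.cons m n) := by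
  rw [← (Fin.consEquiv (fun _ : Fin (k + 1) => ℕ+)).tsum_eq, ENNReal.tsum_prod']
  rfl

lemma one_le_coe_pnat (m : ℕ+) : (1 : ℝ) ≤ ((m : ℕ) : ℝ) := by
  exact_mod_cast m.pos

lemma coe_pnat_pos (m : ℕ+) : (0 : ℝ) < ((m : ℕ) : ℝ) :=
  lt_of_lt_of_le one_pos (one_le_coe_pnat m)

lemma one_le_size {d : ℕ} (n : Lattice d) : 1 ≤ size n :=
  Finset.prod_induction _ (fun x => 1 ≤ x) (fun _ _ h h' => one_le_mul_of_one_le_of_one_le h h')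
    le_rfl fun i _ => one_le_coe_pnat (n i)

lemma size_pos {d : ℕ} (n : Lattice d) : 0 < size n := lt_of_lt_of_le one_pos (one_le_size n)

lemma sizePow_pos {d : ℕ} (α : Fin d → ℝ) (n : Lattice d) : 0 < sizePow α n :=
  Finset.prod_pos fun _ _ => Real.rpow_pos_of_pos (coe_pnat_pos _) _

/-- The increments of `m ↦ m ^ (-δ)` dominate `m ^ (-(1 + δ))`. -/
lemma rpow_neg_le_sub {δ : ℝ} (hδ : 0 < δ) {m : ℝ} (hm : 1 ≤ m) :
    m ^ (-(1 + δ)) ≤ ((1 + δ / 2) / (δ / 2)) * (m ^ (-δ) - (m + 1) ^ (-δ)) := by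
  have hm0 : 0 < m := by linarith
  set x : ℝ := m⁻¹ with hx
  have hx0 : 0 < x := inv_pos.2 hm0
  have hx1 : x ≤ 1 := inv_le_one_of_one_le₀ hm
  have e1 : (m + 1) ^ (-δ) = m ^ (-δ) * (1 + x) ^ (-δ) := by
    rw [← Real.mul_rpow hm0.le (by linarith)]
    congr 1
    rw [mul_add, mul_one, hx, mul_inv_cancel₀ hm0.ne']
  have e2 : m ^ (-(1 + δ)) = m ^ (-δ) * x := by
    rw [neg_add, add_comm, Real.rpow_add hm0, Real.rpow_neg_one]
  have hs : 0 < δ * x / 2 := by positivity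
  -- For `0 < x ≤ 1`, `log (1 + x) ≥ x / (1 + x) ≥ x / 2`; then `exp s ≥ 1 + s` with `s = δ x / 2`.
  have e3 : (1 + x) ^ (-δ) ≤ (1 + δ * x / 2)⁻¹ := by
    have hlog : x / 2 ≤ Real.log (1 + x) := by
      have := Real.one_sub_inv_le_log_of_pos (show 0 < 1 + x by linarith)
      refine le_trans ?_ this
      rw [le_sub_iff_add_le, ← le_sub_iff_add_le', inv_le_comm₀ (by linarith) (by linarith)]
      rw [inv_le_iff_one_le_mul₀ (by linarith)]
      nlinarith
    rw [Real.rpow_def_of_pos (by linarith)]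
    have h1 : Real.log (1 + x) * -δ ≤ -(δ * x / 2) := by nlinarith
    refine (Real.exp_le_exp.2 h1).trans ?_
    rw [Real.exp_neg]
    exact inv_anti₀ (by linarith) (by linarith [Real.add_one_le_exp (δ * x / 2)])
  have e4 : x ≤ ((1 + δ / 2) / (δ / 2)) * (1 - (1 + x) ^ (-δ)) := by
    have h1 : 1 - (1 + δ * x / 2)⁻¹ ≤ 1 - (1 + x) ^ (-δ) := by linarith
    have h2 : x ≤ ((1 + δ / 2) / (δ / 2)) * (1 - (1 + δ * x / 2)⁻¹) := by
      have : 1 - (1 + δ * x / 2)⁻¹ = (δ * x / 2) / (1 + δ * x / 2) := by field_simp; ring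
      rw [this, div_mul_div_comm, le_div_iff₀ (by positivity)]
      nlinarith [mul_pos hδ hx0, mul_pos (mul_pos hδ hδ) hx0,
        mul_nonneg (mul_pos (mul_pos hδ hδ) hx0).le (sub_nonneg.2 hx1)]
    exact h2.trans (mul_le_mul_of_nonneg_left h1 (by positivity))
  rw [e1, e2]
  have := mul_le_mul_of_nonneg_left e4 (Real.rpow_nonneg hm0.le (-δ))
  linarith

/-! ### Weighted sums over a single coordinate -/

lemma tsum_pnat_tail_le {δ : ℝ} (hδ : 0 < δ) :
    ∃ C : ℝ, 0 < C ∧ ∀ w : ℝ, 0 < w →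
      ∑' m : ℕ+, ENNReal.ofReal (if w < ((m : ℕ) : ℝ) then ((m : ℕ) : ℝ) ^ (-(1 + δ)) else 0) ≤
        ENNReal.ofReal (C * w ^ (-δ)) := by
  refine ⟨(1 + δ / 2) / (δ / 2), by positivity, fun w hw => ?_⟩
  set C := (1 + δ / 2) / (δ / 2) with hC
  have hC0 : 0 < C := by positivity
  -- bounded by a telescoping sum of `min (m ^ (-δ)) (w ^ (-δ))`
  let u : ℕ → ℝ := fun m => C * min (((m + 1 : ℕ) : ℝ) ^ (-δ)) (w ^ (-δ))
  have hanti : ∀ m : ℕ, (((m + 1 + 1 : ℕ) : ℝ)) ^ (-δ) ≤ (((m + 1 : ℕ) : ℝ)) ^ (-δ) := fun m =>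
    Real.rpow_le_rpow_of_nonpos (by positivity) (by push_cast; linarith) (by linarith)
  have hterm : ∀ m : ℕ, (if w < ((m + 1 : ℕ) : ℝ) then ((m + 1 : ℕ) : ℝ) ^ (-(1 + δ)) else 0) ≤
      u m - u (m + 1) := by
    intro m
    simp only [u]
    split_ifs with h
    · have h1 : (((m + 1 : ℕ) : ℝ)) ^ (-δ) ≤ w ^ (-δ) :=
        Real.rpow_le_rpow_of_nonpos hw h.le (by linarith)
      rw [min_eq_left h1, min_eq_left ((hanti m).trans h1), ← mul_sub]
      have := rpow_neg_le_sub hδ (m := ((m + 1 : ℕ) : ℝ)) (by push_cast; linarith [m.cast_nonneg (α := ℝ)])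
      refine this.trans_eq ?_
      push_cast; rfl
    · rw [← mul_sub]
      exact mul_nonneg hC0.le (sub_nonneg.2 (min_le_min_right _ (hanti m)))
  rw [tsum_pnat_eq_tsum_succ (f := fun m : ℕ => ENNReal.ofReal (if w < (m : ℝ) then (m : ℝ) ^ (-(1 + δ)) else 0))]
  refine ENNReal.tsum_le_of_sum_range_le fun N => ?_
  rw [← ENNReal.ofReal_sum_of_nonneg fun i _ => by split_ifs <;> positivity]
  refine ENNReal.ofReal_le_ofReal ((Finset.sum_le_sum fun i _ => hterm i).trans ?_)
  rw [Finset.sum_range_sub']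
  have h0 : 0 ≤ u N := mul_nonneg hC0.le (le_min (by positivity) (by positivity))
  have : u 0 ≤ C * w ^ (-δ) := mul_le_mul_of_nonneg_left (min_le_right _ _) hC0.le
  linarith

lemma tsum_pnat_le_eq {f : ℕ → ℝ} (hf : ∀ m, 0 ≤ f m) (w : ℝ) (hw : 0 ≤ w) :
    ∑' m : ℕ+, ENNReal.ofReal (if ((m : ℕ) : ℝ) ≤ w then f m else 0) =
      ENNReal.ofReal (∑ m ∈ Finset.range ⌊w⌋₊, f (m + 1)) := by
  rw [tsum_pnat_eq_tsum_succ (f := fun m : ℕ => ENNReal.ofReal (if (m : ℝ) ≤ w then f m else 0)),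
    tsum_eq_sum (s := Finset.range ⌊w⌋₊), ENNReal.ofReal_sum_of_nonneg fun i _ => hf _]
  · refine Finset.sum_congr rfl fun i hi => ?_
    rw [if_pos]
    exact (Nat.le_floor_iff hw).1 (Finset.mem_range.1 hi)
  · intro b hb
    rw [if_neg, ENNReal.ofReal_zero]
    rw [Finset.mem_range, not_lt] at hb
    intro h
    have := Nat.le_floor h
    omega

lemma tsum_pnat_inv_le {w : ℝ} (hw : 1 ≤ w) :
    ∑' m : ℕ+, ENNReal.ofReal (if ((m : ℕ) : ℝ) ≤ w then ((m : ℕ) : ℝ)⁻¹ else 0) ≤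
      ENNReal.ofReal (1 + Real.log w) := by
  rw [tsum_pnat_le_eq (f := fun m : ℕ => (m : ℝ)⁻¹) (fun m => by positivity) w (by linarith)]
  refine ENNReal.ofReal_le_ofReal ?_
  have := harmonic_floor_le_one_add_log w hw
  simpa [harmonic] using this

lemma tsum_pnat_rpow_le {b w : ℝ} (hb : 1 ≤ b) (hw : 0 < w) :
    ∑' m : ℕ+, ENNReal.ofReal (if ((m : ℕ) : ℝ) ≤ w then ((m : ℕ) : ℝ) ^ (b - 1) else 0) ≤
      ENNReal.ofReal (w ^ b) := by
  rw [tsum_pnat_le_eq (f := fun m : ℕ => (m : ℝ) ^ (b - 1)) (fun m => by positivity) w hw.le]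
  refine ENNReal.ofReal_le_ofReal ?_
  have h1 : ∀ m ∈ Finset.range ⌊w⌋₊, ((m + 1 : ℕ) : ℝ) ^ (b - 1) ≤ w ^ (b - 1) := fun m hm =>
    Real.rpow_le_rpow (by positivity) ((Nat.le_floor_iff hw.le).1 (Finset.mem_range.1 hm))
      (by linarith)
  refine (Finset.sum_le_sum h1).trans ?_
  rw [Finset.sum_const, Finset.card_range, nsmul_eq_mul]
  calc (⌊w⌋₊ : ℝ) * w ^ (b - 1) ≤ w * w ^ (b - 1) := by
        gcongr; exact Nat.floor_le hw.le
    _ = w ^ b := by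
        rw [← Real.rpow_one_add' hw.le (by linarith)]; congr 1; ring

lemma tsum_pnat_rpow_const_le {δ : ℝ} (hδ : 0 < δ) :
    ∃ C : ℝ, 0 < C ∧
      ∑' m : ℕ+, ENNReal.ofReal (((m : ℕ) : ℝ) ^ (-(1 + δ))) ≤ ENNReal.ofReal C := by
  obtain ⟨C, hC, h⟩ := tsum_pnat_tail_le hδ
  -- The threshold `1/2` lies below every positive integer, so the tail is the whole series.
  refine ⟨C * (1 / 2) ^ (-δ), by positivity, le_trans (ENNReal.tsum_le_tsum fun m => ?_)
    (h (1 / 2) (by norm_num))⟩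
  rw [if_pos (by linarith [one_le_coe_pnat m])]

/-- The growth function `z ^ q` near zero, `z ^ r * (1 + log z) ^ j` at infinity. -/
noncomputable def envelope (q r : ℝ) (j : ℕ) (z : ℝ) : ℝ :=
  if z ≤ 1 then z ^ q else z ^ r * (1 + Real.log z) ^ j

/-- Splitting a weighted sum over `m` at `m = z ^ (1 / a)`. -/
lemma tsum_split_le {q a b : ℝ} (ha : 0 < a) (hq : b < a * q) :
    ∃ C : ℝ, 0 < C ∧ ∀ (z : ℝ) (_ : 1 < z) (f g : ℕ → ℝ), (∀ m, 0 ≤ f m) →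
      (∀ m : ℕ, 1 ≤ m → (m : ℝ) ^ a ≤ z → g m ≤ f m) →
      (∀ m : ℕ, 1 ≤ m → z < (m : ℝ) ^ a → g m ≤ (m : ℝ) ^ (b - 1) * (z / (m : ℝ) ^ a) ^ q) →
      ∑' m : ℕ+, ENNReal.ofReal (g m) ≤
        ∑' m : ℕ+, ENNReal.ofReal (if ((m : ℕ) : ℝ) ≤ z ^ (1 / a) then f m else 0) +
          ENNReal.ofReal (C * z ^ (b / a)) := by
  obtain ⟨C, hC, h⟩ := tsum_pnat_tail_le (δ := a * q - b) (by linarith)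
  refine ⟨C, hC, fun z hz f g hf h1 h2 => ?_⟩
  have hz0 : 0 < z := by linarith
  -- `m ^ a ≤ z` is the same as `m ≤ w`; beyond `w` the tail bound gives `z ^ q * w ^ (-(a q - b)) =
  -- z ^ (b / a)`.
  set w := z ^ (1 / a) with hw
  have hw0 : 0 < w := Real.rpow_pos_of_pos hz0 _
  have hwa : w ^ a = z := by
    rw [hw, ← Real.rpow_mul hz0.le, one_div_mul_cancel ha.ne', Real.rpow_one]
  have key : ∀ m : ℕ+, ENNReal.ofReal (g m) ≤
      ENNReal.ofReal (if ((m : ℕ) : ℝ) ≤ w then f m else 0) + ENNReal.ofReal (z ^ q) *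
        ENNReal.ofReal (if w < ((m : ℕ) : ℝ) then ((m : ℕ) : ℝ) ^ (-(1 + (a * q - b))) else 0) := by
    intro m
    have hm := coe_pnat_pos m
    by_cases hmw : ((m : ℕ) : ℝ) ≤ w
    · rw [if_pos hmw, if_neg (not_lt.2 hmw), ENNReal.ofReal_zero, mul_zero, add_zero]
      refine ENNReal.ofReal_le_ofReal (h1 m m.pos ?_)
      rw [← hwa]
      exact Real.rpow_le_rpow hm.le hmw ha.le
    · rw [if_neg hmw, if_pos (not_le.1 hmw), ENNReal.ofReal_zero, zero_add,
        ← ENNReal.ofReal_mul (by positivity)]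
      refine ENNReal.ofReal_le_ofReal ((h2 m m.pos ?_).trans_eq ?_)
      · rw [← hwa]
        exact Real.rpow_lt_rpow hw0.le (not_le.1 hmw) ha
      · rw [Real.div_rpow hz0.le (by positivity), ← Real.rpow_mul hm.le, mul_div_assoc', mul_comm,
          mul_div_assoc, ← Real.rpow_sub hm]
        congr 2; ring
  refine (ENNReal.tsum_le_tsum key).trans ?_
  rw [ENNReal.tsum_add, ENNReal.tsum_mul_left]
  gcongr
  refine (mul_le_mul_right (h w hw0) _).trans ?_
  rw [← ENNReal.ofReal_mul (by positivity)]
  refine ENNReal.ofReal_le_ofReal (le_of_eq ?_)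
  have : w ^ (-(a * q - b)) = z ^ (b / a - q) := by
    rw [hw, ← Real.rpow_mul hz0.le]; congr 1; field_simp; ring
  rw [this, mul_left_comm, ← Real.rpow_add hz0]
  congr 2; ring

lemma tsum_small_le {q a b : ℝ} (hq : b < a * q) :
    ∃ C : ℝ, 0 < C ∧ ∀ z : ℝ, 0 < z →
      ∑' m : ℕ+, ENNReal.ofReal (((m : ℕ) : ℝ) ^ (b - 1) * (z / ((m : ℕ) : ℝ) ^ a) ^ q) ≤
        ENNReal.ofReal (C * z ^ q) := by
  obtain ⟨C, hC, h⟩ := tsum_pnat_rpow_const_le (δ := a * q - b) (by linarith)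
  refine ⟨C, hC, fun z hz => ?_⟩
  have key : ∀ m : ℕ+,
      ENNReal.ofReal (((m : ℕ) : ℝ) ^ (b - 1) * (z / ((m : ℕ) : ℝ) ^ a) ^ q) =
        ENNReal.ofReal (z ^ q) * ENNReal.ofReal (((m : ℕ) : ℝ) ^ (-(1 + (a * q - b)))) := by
    intro m
    have hm := coe_pnat_pos m
    rw [← ENNReal.ofReal_mul (by positivity), Real.div_rpow hz.le (by positivity),
      ← Real.rpow_mul hm.le, mul_div_assoc', mul_comm, mul_div_assoc, ← Real.rpow_sub hm]
    congr 3; ring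
  rw [tsum_congr key, ENNReal.tsum_mul_left, mul_comm C, ENNReal.ofReal_mul (by positivity)]
  exact mul_le_mul_right h _

lemma min_one_rpow_of_le {x q : ℝ} (hx : x ≤ 1) : (min 1 x) ^ q = x ^ q := by
  rw [min_eq_right hx]

/-- This is the coordinate that produces the power: `∑ m ^ (a r - 1)` over `m ≤ z ^ (1 / a)` is at
most `z ^ r`, with no logarithm, and the terms beyond contribute the same order because `q > r`. -/
lemma tsum_envelope_base {q r a : ℝ} (ha : 0 < a) (hr : 1 ≤ a * r) (hqr : r < q) :
    ∃ C : ℝ, 0 < C ∧ ∀ z : ℝ, 0 < z →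
      ∑' m : ℕ+, ENNReal.ofReal (((m : ℕ) : ℝ) ^ (a * r - 1) *
        (min 1 (z / ((m : ℕ) : ℝ) ^ a)) ^ q) ≤ ENNReal.ofReal (C * envelope q r 0 z) := by
  have hlt : a * r < a * q := mul_lt_mul_of_pos_left hqr ha
  obtain ⟨C₁, hC₁, h₁⟩ := tsum_small_le (a := a) hlt
  obtain ⟨C₂, hC₂, h₂⟩ := tsum_split_le ha hlt
  refine ⟨C₁ + (1 + C₂), by positivity, fun z hz => ?_⟩
  have hr0 : 0 < r := by by_contra h; nlinarith
  by_cases hz1 : z ≤ 1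
  · rw [envelope, if_pos hz1]
    refine (le_trans (ENNReal.tsum_le_tsum fun m => ?_) (h₁ z hz)).trans
      (ENNReal.ofReal_le_ofReal ?_)
    · rw [min_one_rpow_of_le]
      exact (div_le_one₀ (by positivity)).2
        (hz1.trans (Real.one_le_rpow (one_le_coe_pnat m) ha.le))
    · nlinarith [Real.rpow_pos_of_pos hz q]
  · have hz1' := not_le.1 hz1
    rw [envelope, if_neg hz1, pow_zero, mul_one]
    refine (h₂ z hz1' (fun m => (m : ℝ) ^ (a * r - 1))
      (fun m => (m : ℝ) ^ (a * r - 1) * (min 1 (z / (m : ℝ) ^ a)) ^ q)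
      (fun m => by positivity) ?_ ?_).trans ?_
    · intro m _ _
      refine mul_le_of_le_one_right (by positivity)
        (Real.rpow_le_one (le_min zero_le_one (by positivity)) (min_le_left _ _) (by linarith))
    · intro m hm h
      rw [min_one_rpow_of_le ((div_le_one₀ (hz.trans h)).2 h.le)]
    · refine (add_le_add_left (tsum_pnat_rpow_le hr (by positivity)) _).trans ?_
      rw [← ENNReal.ofReal_add (by positivity) (by positivity)]
      refine ENNReal.ofReal_le_ofReal ?_
      rw [← Real.rpow_mul hz.le, mul_div_cancel_left₀ _ ha.ne',
        show 1 / a * (a * r) = r by field_simp]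
      nlinarith [Real.rpow_pos_of_pos hz r]

open Classical in
-- In the range `m ^ a ≤ z` the power `z ^ r` factors out and `∑ m ^ (-(1 + (a r - b)))` remains: a
-- harmonic sum, costing one logarithm, if `b = a r`, and a convergent series if `b < a r`. The
-- range `m ^ a > z` adds only `z ^ (b / a) ≤ z ^ r`.
lemma tsum_envelope_step {q r a b : ℝ} (ha : 0 < a) (hqr : r < q) (hb : b ≤ a * r)
    (j : ℕ) :
    ∃ C : ℝ, 0 < C ∧ ∀ z : ℝ, 0 < z →
      ∑' m : ℕ+, ENNReal.ofReal (((m : ℕ) : ℝ) ^ (b - 1) *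
        envelope q r j (z / ((m : ℕ) : ℝ) ^ a)) ≤
      ENNReal.ofReal (C * envelope q r (if b = a * r then j + 1 else j) z) := by
  have hlt : b < a * q := hb.trans_lt (mul_lt_mul_of_pos_left hqr ha)
  obtain ⟨C₁, hC₁, h₁⟩ := tsum_small_le (a := a) hlt
  obtain ⟨C₂, hC₂, h₂⟩ := tsum_split_le ha hlt
  have hpart : ∃ C : ℝ, 0 < C ∧ ∀ z : ℝ, 1 < z →
      ∑' m : ℕ+, ENNReal.ofReal (if ((m : ℕ) : ℝ) ≤ z ^ (1 / a) then
        ((m : ℕ) : ℝ) ^ (-(1 + (a * r - b))) else 0) ≤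
      ENNReal.ofReal (C * (1 + Real.log z) ^ (if b = a * r then 1 else 0)) := by
    by_cases hba : b = a * r
    · refine ⟨1 + 1 / a, by positivity, fun z hz => ?_⟩
      have hlog := Real.log_nonneg hz.le
      simp only [hba, sub_self, add_zero, Real.rpow_neg_one, if_true, pow_one]
      refine (tsum_pnat_inv_le (Real.one_le_rpow hz.le (by positivity))).trans
        (ENNReal.ofReal_le_ofReal ?_)
      rw [Real.log_rpow (by linarith)]
      have : 0 < 1 / a := by positivity
      nlinarith
    · obtain ⟨C, hC, h⟩ := tsum_pnat_rpow_const_le (δ := a * r - b)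
        (sub_pos.2 (lt_of_le_of_ne hb hba))
      refine ⟨C, hC, fun z hz => ?_⟩
      rw [if_neg hba, pow_zero, mul_one]
      refine (ENNReal.tsum_le_tsum fun m => ENNReal.ofReal_le_ofReal ?_).trans h
      split_ifs
      · exact le_rfl
      · positivity
  obtain ⟨C₃, hC₃, h₃⟩ := hpart
  refine ⟨C₁ + (C₃ + C₂), by positivity, fun z hz => ?_⟩
  by_cases hz1 : z ≤ 1
  · rw [envelope, if_pos hz1]
    refine (le_trans (ENNReal.tsum_le_tsum fun m => ?_) (h₁ z hz)).trans
      (ENNReal.ofReal_le_ofReal ?_)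
    · rw [envelope, if_pos]
      exact (div_le_one₀ (by positivity)).2
        (hz1.trans (Real.one_le_rpow (one_le_coe_pnat m) ha.le))
    · nlinarith [Real.rpow_pos_of_pos hz q]
  · have hz1' := not_le.1 hz1
    have hlog := Real.log_nonneg hz1'.le
    set L := 1 + Real.log z with hL
    have hL1 : 1 ≤ L := by linarith
    have hexp : envelope q r (if b = a * r then j + 1 else j) z =
        z ^ r * L ^ j * L ^ (if b = a * r then 1 else 0) := by
      rw [envelope, if_neg hz1, mul_assoc, ← pow_add]
      congr 2
      split_ifs <;> rfl
    rw [hexp]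
    refine (h₂ z hz1' (fun m => z ^ r * L ^ j * (m : ℝ) ^ (-(1 + (a * r - b))))
      (fun m => (m : ℝ) ^ (b - 1) * envelope q r j (z / (m : ℝ) ^ a))
      (fun m => by positivity) ?_ ?_).trans ?_
    · intro m hm hmz
      have hm1 : (1 : ℝ) ≤ m := by exact_mod_cast hm
      have hm0 : (0 : ℝ) < m := by linarith
      have hma : 0 < (m : ℝ) ^ a := by positivity
      have h1z : 1 ≤ z / (m : ℝ) ^ a := (one_le_div₀ hma).2 hmz
      -- At the argument `1` the first branch of `envelope` applies, but both branches have value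
      -- `1` there.
      have henv : envelope q r j (z / (m : ℝ) ^ a) ≤ (z / (m : ℝ) ^ a) ^ r * L ^ j := by
        unfold envelope
        split_ifs with h
        · have h1 : z / (m : ℝ) ^ a = 1 := le_antisymm h h1z
          rw [h1, Real.one_rpow, Real.one_rpow, one_mul]
          exact one_le_pow₀ hL1
        · have : Real.log (z / (m : ℝ) ^ a) ≤ Real.log z :=
            Real.log_le_log (by positivity) (div_le_self hz.le (Real.one_le_rpow hm1 ha.le))
          have h0 := Real.log_nonneg h1z
          gcongr
          linarith
      refine (mul_le_mul_of_nonneg_left henv (by positivity)).trans_eq ?_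
      rw [Real.div_rpow hz.le hma.le, ← Real.rpow_mul hm0.le]
      have : (m : ℝ) ^ (-(1 + (a * r - b))) = (m : ℝ) ^ (b - 1) / (m : ℝ) ^ (a * r) := by
        rw [← Real.rpow_sub hm0]; congr 1; ring
      rw [this]; ring
    · intro m hm h
      rw [envelope, if_pos ((div_le_one₀ (hz.trans h)).2 h.le)]
    · have e1 : ∀ m : ℕ+, ENNReal.ofReal (if ((m : ℕ) : ℝ) ≤ z ^ (1 / a) then
          z ^ r * L ^ j * ((m : ℕ) : ℝ) ^ (-(1 + (a * r - b))) else 0) =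
          ENNReal.ofReal (z ^ r * L ^ j) * ENNReal.ofReal (if ((m : ℕ) : ℝ) ≤ z ^ (1 / a) then
            ((m : ℕ) : ℝ) ^ (-(1 + (a * r - b))) else 0) := by
        intro m
        rw [← ENNReal.ofReal_mul (by positivity), mul_ite, mul_zero]
      rw [tsum_congr e1, ENNReal.tsum_mul_left]
      refine (add_le_add_left (mul_le_mul_right (h₃ z hz1') _) _).trans ?_
      rw [← ENNReal.ofReal_mul (by positivity), ← ENNReal.ofReal_add (by positivity) (by positivity)]
      refine ENNReal.ofReal_le_ofReal ?_
      set T := L ^ (if b = a * r then 1 else 0) with hT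
      have hT1 : 1 ≤ T := one_le_pow₀ hL1
      have hj1 : 1 ≤ L ^ j := one_le_pow₀ hL1
      have hzb : z ^ (b / a) ≤ z ^ r := by
        refine Real.rpow_le_rpow_of_exponent_le hz1'.le ?_
        rw [div_le_iff₀ ha]; linarith
      have hzr : 0 < z ^ r := by positivity
      have h5 : z ^ r ≤ z ^ r * L ^ j * T := by
        rw [mul_assoc]
        exact le_mul_of_one_le_right hzr.le (one_le_mul_of_one_le_of_one_le hj1 hT1)
      have h6 := mul_le_mul_of_nonneg_left (hzb.trans h5) hC₂.le
      have h7 : 0 ≤ C₁ * (z ^ r * L ^ j * T) := by positivity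
      nlinarith

/-! ### Upper bound for the weighted count over the lattice -/

open Classical in
-- Induction on the number of coordinates: the bound for the remaining coordinates is fed into the
-- one-coordinate step, and the exponent of the logarithm counts the critical coordinates. `F` is
-- left arbitrary so that the sum over a distinguished coordinate can be inserted.
lemma tsum_lattice_envelope {q r b : ℝ} (hqr : r < q) {k : ℕ} (α : Fin k → ℝ)
    (hα : ∀ i, 0 < α i ∧ b ≤ α i * r) (j : ℕ) (F : ℝ → ENNReal) {C : ℝ} (hC : 0 < C)
    (hF : ∀ z, 0 < z → F z ≤ ENNReal.ofReal (C * envelope q r j z)) :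
    ∃ C' : ℝ, 0 < C' ∧ ∀ z, 0 < z →
      ∑' n : Lattice k, ENNReal.ofReal (size n ^ (b - 1)) * F (z / sizePow α n) ≤
        ENNReal.ofReal (C' * envelope q r
          (j + (Finset.univ.filter fun i => b = α i * r).card) z) := by
  induction k with
  | zero =>
    refine ⟨C, hC, fun z hz => ?_⟩
    rw [tsum_fintype, Fintype.sum_unique]
    simpa [size, sizePow] using hF z hz
  | succ k ih =>
    obtain ⟨C₁, hC₁, h₁⟩ := ih (fun i => α i.succ) (fun i => hα i.succ)
    set c := (Finset.univ.filter fun i : Fin k => b = α i.succ * r).card with hc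
    obtain ⟨C₂, hC₂, h₂⟩ := tsum_envelope_step (hα 0).1 hqr (hα 0).2 (j + c)
    refine ⟨C₁ * C₂, by positivity, fun z hz => ?_⟩
    rw [tsum_lattice_succ]
    have hcard : j + (Finset.univ.filter fun i => b = α i * r).card =
        if b = α 0 * r then j + c + 1 else j + c := by
      rw [Fin.card_filter_univ_succ]
      split_ifs <;> simp [hc]
      ring
    rw [hcard]
    have hterm : ∀ m : ℕ+, ∑' n : Lattice k, ENNReal.ofReal (size (Fin.cons m n : Lattice (k + 1)) ^ (b - 1)) *
        F (z / sizePow α (Fin.cons m n : Lattice (k + 1))) ≤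
        ENNReal.ofReal C₁ * ENNReal.ofReal (((m : ℕ) : ℝ) ^ (b - 1) *
          envelope q r (j + c) (z / ((m : ℕ) : ℝ) ^ α 0)) := by
      intro m
      have hm := coe_pnat_pos m
      have e : ∀ n : Lattice k, ENNReal.ofReal (size (Fin.cons m n : Lattice (k + 1)) ^ (b - 1)) *
          F (z / sizePow α (Fin.cons m n : Lattice (k + 1))) =
          ENNReal.ofReal (((m : ℕ) : ℝ) ^ (b - 1)) * (ENNReal.ofReal (size n ^ (b - 1)) *
            F (z / ((m : ℕ) : ℝ) ^ α 0 / sizePow (fun i => α i.succ) n)) := by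
        intro n
        rw [size_cons, sizePow_cons, Real.mul_rpow hm.le (size_pos n).le,
          ENNReal.ofReal_mul (by positivity), mul_assoc, div_div]
      rw [tsum_congr e, ENNReal.tsum_mul_left]
      refine (mul_le_mul_right (h₁ _ (by positivity)) _).trans_eq ?_
      rw [← ENNReal.ofReal_mul (by positivity), ← ENNReal.ofReal_mul (by positivity)]
      congr 1; ring
    refine (ENNReal.tsum_le_tsum hterm).trans ?_
    rw [ENNReal.tsum_mul_left, mul_assoc, ENNReal.ofReal_mul hC₁.le]
    exact mul_le_mul_right (h₂ z hz) _

/-- The weighted count of lattice points, with the exact power of the logarithm. -/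
theorem tsum_lattice_min_le {q r a : ℝ} (ha : 0 < a) (har : 1 ≤ a * r) (hqr : r < q) {k : ℕ}
    (α : Fin (k + 1) → ℝ) (h0 : α 0 = a) (hα : ∀ i, a ≤ α i) :
    ∃ C : ℝ, 0 < C ∧ ∀ z, 0 < z →
      ∑' n : Lattice (k + 1), ENNReal.ofReal (size n ^ (a * r - 1) * (min 1 (z / sizePow α n)) ^ q) ≤
        ENNReal.ofReal (C * envelope q r
          ((Finset.univ.filter fun i : Fin k => α i.succ = a).card) z) := by
  classical
  have hr : 0 < r := by by_contra h; nlinarith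
  obtain ⟨C₁, hC₁, h₁⟩ := tsum_envelope_base ha har hqr
  -- Coordinate `0` is summed innermost and gives `z ^ r` without logarithm; only the other
  -- coordinates with exponent `a` are counted, hence `p - 1` instead of `p`.
  obtain ⟨C, hC, h⟩ := tsum_lattice_envelope (b := a * r) hqr (fun i : Fin k => α i.succ)
    (fun i => ⟨ha.trans_le (hα _), mul_le_mul_of_nonneg_right (hα _) hr.le⟩) 0
    (fun z => ∑' m : ℕ+, ENNReal.ofReal (((m : ℕ) : ℝ) ^ (a * r - 1) *
        (min 1 (z / ((m : ℕ) : ℝ) ^ a)) ^ q)) hC₁ h₁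
  refine ⟨C, hC, fun z hz => ?_⟩
  have hcard : (Finset.univ.filter fun i : Fin k => α i.succ = a).card =
      0 + (Finset.univ.filter fun i : Fin k => a * r = α i.succ * r).card := by
    rw [zero_add]
    congr 1
    ext i
    simp only [Finset.mem_filter, Finset.mem_univ, true_and, mul_left_inj' hr.ne', eq_comm]
  rw [hcard]
  refine le_trans (le_of_eq ?_) (h z hz)
  rw [tsum_lattice_succ, ENNReal.tsum_comm]
  refine tsum_congr fun n => ?_
  rw [← ENNReal.tsum_mul_left]
  refine tsum_congr fun m => ?_
  have hm := coe_pnat_pos m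
  have hn := size_pos n
  rw [size_cons, sizePow_cons, h0, Real.mul_rpow hm.le hn.le,
    ← ENNReal.ofReal_mul (by positivity), mul_comm (((m : ℕ) : ℝ) ^ a), div_div]
  congr 1; ring

/-! ### Lower bound for the weighted count -/

lemma ofReal_sum_le_tsum_pnat {f : ℕ → ℝ} (hf : ∀ m, 0 ≤ f m) (s : Finset ℕ)
    (hs : ∀ m ∈ s, 1 ≤ m) (g : ℕ+ → ENNReal)
    (hg : ∀ m : ℕ+, (m : ℕ) ∈ s → ENNReal.ofReal (f m) ≤ g m) :
    ENNReal.ofReal (∑ m ∈ s, f m) ≤ ∑' m : ℕ+, g m := by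
  classical
  rw [ENNReal.ofReal_sum_of_nonneg fun i _ => hf i]
  have : ∑ m ∈ s, ENNReal.ofReal (f m) =
      ∑ m ∈ s.attach.map ⟨fun m => (⟨m.1, hs m.1 m.2⟩ : ℕ+), fun a b h => by
        have := congrArg PNat.val h
        exact Subtype.ext this⟩, ENNReal.ofReal (f m) := by
    rw [Finset.sum_map]
    exact (Finset.sum_attach s fun m => ENNReal.ofReal (f m)).symm
  rw [this]
  refine (Finset.sum_le_sum fun m hm => hg m ?_).trans (ENNReal.sum_le_tsum _)
  obtain ⟨x, _, rfl⟩ := Finset.mem_map.1 hm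
  exact x.2

lemma exists_log_ge (A : ℝ) : ∃ Z : ℝ, 1 < Z ∧ ∀ z, Z ≤ z → A ≤ Real.log z :=
  ⟨Real.exp (|A| + 1), Real.one_lt_exp_iff.2 (by positivity), fun z hz => by
    have := Real.log_le_log (Real.exp_pos _) hz
    rw [Real.log_exp] at this
    linarith [le_abs_self A]⟩

/-- With `w = z ^ (1 / a)`, at least `w / 4` integers lie between `w / 2` and `w`, each of weight at
least `(w / 2) ^ (a r - 1)`, and `w * w ^ (a r - 1) = z ^ r`. -/
lemma le_tsum_base {r a : ℝ} (ha : 0 < a) (hr : 1 ≤ a * r) (m₀ : ℕ+) :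
    ∃ c Z : ℝ, 0 < c ∧ 1 < Z ∧ ∀ z : ℝ, Z ≤ z →
      ENNReal.ofReal (c * z ^ r) ≤ ∑' m : ℕ+,
        if m₀ ≤ m ∧ ((m : ℕ) : ℝ) ^ a < z then ENNReal.ofReal (((m : ℕ) : ℝ) ^ (a * r - 1)) else 0 := by
  -- `w ≥ 2 m₀` puts the range beyond `m₀`; `w ≥ 8` gives `w / 2 - 2 ≥ w / 4`, which absorbs the
  -- rounding.
  set A : ℝ := 2 * m₀ + 8 with hA
  have hm₀ := one_le_coe_pnat m₀
  have hA1 : 1 < A := by linarith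
  refine ⟨(1 / 2) ^ (a * r - 1) / 4, A ^ a, by positivity, Real.one_lt_rpow hA1 ha, fun z hz => ?_⟩
  have hz0 : 0 < z := lt_of_lt_of_le (by positivity) hz
  set w := z ^ (1 / a) with hw
  have hw0 : 0 < w := Real.rpow_pos_of_pos hz0 _
  have hwa : w ^ a = z := by
    rw [hw, ← Real.rpow_mul hz0.le, one_div_mul_cancel ha.ne', Real.rpow_one]
  have hAw : A ≤ w := by
    rw [← Real.rpow_le_rpow_iff (by positivity) hw0.le ha, hwa]; exact hz
  set N := ⌊w / 2⌋₊ with hN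
  have hN1 : (N : ℝ) ≤ w / 2 := Nat.floor_le (by positivity)
  have hN2 : w / 2 < N + 1 := Nat.lt_floor_add_one _
  have hmem : ∀ m : ℕ, m ∈ Finset.Ico (N + 1) (2 * N) → w / 2 < m ∧ (m : ℝ) < w := by
    intro m hm
    obtain ⟨h1, h2⟩ := Finset.mem_Ico.1 hm
    have h1' : ((N + 1 : ℕ) : ℝ) ≤ m := by exact_mod_cast h1
    have h2' : (m : ℝ) < ((2 * N : ℕ) : ℝ) := by exact_mod_cast h2
    push_cast at h1' h2'
    constructor <;> linarith
  refine le_trans ?_ (ofReal_sum_le_tsum_pnat (f := fun m => (m : ℝ) ^ (a * r - 1))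
    (fun m => by positivity) (Finset.Ico (N + 1) (2 * N))
    (fun m hm => by have := (Finset.mem_Ico.1 hm).1; omega) _ ?_)
  · refine ENNReal.ofReal_le_ofReal ?_
    have h1 : ∀ m ∈ Finset.Ico (N + 1) (2 * N), (w / 2) ^ (a * r - 1) ≤ (m : ℝ) ^ (a * r - 1) :=
      fun m hm => Real.rpow_le_rpow (by positivity) (hmem m hm).1.le (by linarith)
    refine le_trans ?_ (Finset.sum_le_sum h1)
    rw [Finset.sum_const, nsmul_eq_mul, Nat.card_Ico]
    have hcard : w / 4 ≤ ((2 * N - (N + 1) : ℕ) : ℝ) := by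
      have : N ≤ (2 * N - (N + 1) : ℕ) + 1 := by omega
      have : (N : ℝ) ≤ ((2 * N - (N + 1) : ℕ) : ℝ) + 1 := by exact_mod_cast this
      linarith
    have hzr : z ^ r = w * w ^ (a * r - 1) := by
      rw [← Real.rpow_one_add' hw0.le (by linarith), hw, ← Real.rpow_mul hz0.le]
      congr 1; field_simp; ring
    rw [div_eq_mul_one_div w, Real.mul_rpow hw0.le (by norm_num), hzr]
    calc (1 / 2 : ℝ) ^ (a * r - 1) / 4 * (w * w ^ (a * r - 1))
        = w / 4 * (w ^ (a * r - 1) * (1 / 2) ^ (a * r - 1)) := by ring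
      _ ≤ _ := mul_le_mul_of_nonneg_right hcard (by positivity)
  · intro m hm
    have h := hmem m hm
    rw [if_pos]
    refine ⟨?_, ?_⟩
    · have : ((m₀ : ℕ) : ℝ) ≤ ((m : ℕ) : ℝ) := by linarith
      exact_mod_cast this
    · rw [← hwa]
      exact Real.rpow_lt_rpow (coe_pnat_pos m).le h.2 ha

open Classical in
-- Only indices with `m ^ (2 a) ≤ z` are kept. There `z / m ^ a ≥ √z`, so its logarithm is at least
-- half of `log z`, whence the factor `(1 / 2) ^ j`. In the critical case the harmonic sum up to `z
-- ^ (1 / (2 a))` supplies the extra logarithm; otherwise the single term `m = m₀` suffices.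
lemma le_tsum_step {r a b : ℝ} (ha : 0 < a) (m₀ : ℕ+) (j : ℕ)
    (F : ℝ → ENNReal) {c Z : ℝ} (hc : 0 < c) (hZ : 1 < Z)
    (hF : ∀ z, Z ≤ z → ENNReal.ofReal (c * z ^ r * Real.log z ^ j) ≤ F z) :
    ∃ c' Z' : ℝ, 0 < c' ∧ 1 < Z' ∧ ∀ z : ℝ, Z' ≤ z →
      ENNReal.ofReal (c' * z ^ r * Real.log z ^ (if b = a * r then j + 1 else j)) ≤
        ∑' m : ℕ+, if m₀ ≤ m then ENNReal.ofReal (((m : ℕ) : ℝ) ^ (b - 1)) *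
          F (z / ((m : ℕ) : ℝ) ^ a) else 0 := by
  have hm₀ := one_le_coe_pnat m₀
  have term : ∀ (m : ℕ+) (z : ℝ), Z ^ 2 ≤ z → (((m : ℕ) : ℝ) ^ a) ^ 2 ≤ z →
      ENNReal.ofReal (c * (1 / 2) ^ j * z ^ r * Real.log z ^ j * ((m : ℕ) : ℝ) ^ (b - 1 - a * r)) ≤
        ENNReal.ofReal (((m : ℕ) : ℝ) ^ (b - 1)) * F (z / ((m : ℕ) : ℝ) ^ a) := by
    intro m z hz hmz
    have hm := coe_pnat_pos m
    have hma : 0 < ((m : ℕ) : ℝ) ^ a := by positivity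
    have hZz : 1 < z := lt_of_lt_of_le (by nlinarith) hz
    have hz0 : 0 < z := by linarith
    have hlog : 0 ≤ Real.log z := Real.log_nonneg hZz.le
    have hsq : (Real.sqrt z) ^ 2 = z := Real.sq_sqrt hz0.le
    have hms : ((m : ℕ) : ℝ) ^ a ≤ Real.sqrt z := Real.le_sqrt_of_sq_le hmz
    have hs0 : 0 < Real.sqrt z := Real.sqrt_pos.2 hz0
    have hge : Real.sqrt z ≤ z / ((m : ℕ) : ℝ) ^ a := by
      rw [le_div_iff₀ hma]; nlinarith
    have hZs : Z ≤ Real.sqrt z := Real.le_sqrt_of_sq_le hz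
    have hl : 1 / 2 * Real.log z ≤ Real.log (z / ((m : ℕ) : ℝ) ^ a) := by
      have := Real.log_le_log hs0 hge
      rw [Real.log_sqrt hz0.le] at this; linarith
    refine le_trans ?_ (mul_le_mul_right (hF _ (hZs.trans hge)) _)
    rw [← ENNReal.ofReal_mul (by positivity)]
    refine ENNReal.ofReal_le_ofReal ?_
    rw [Real.div_rpow hz0.le hma.le, ← Real.rpow_mul hm.le, Real.rpow_sub hm (b - 1)]
    have hp : (1 / 2 * Real.log z) ^ j ≤ Real.log (z / ((m : ℕ) : ℝ) ^ a) ^ j :=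
      pow_le_pow_left₀ (by positivity) hl j
    rw [mul_pow] at hp
    calc c * (1 / 2) ^ j * z ^ r * Real.log z ^ j * (((m : ℕ) : ℝ) ^ (b - 1) / ((m : ℕ) : ℝ) ^ (a * r))
        = ((m : ℕ) : ℝ) ^ (b - 1) * (c * (z ^ r / ((m : ℕ) : ℝ) ^ (a * r)) *
            ((1 / 2) ^ j * Real.log z ^ j)) := by ring
      _ ≤ _ := by gcongr
  by_cases hba : b = a * r
  -- The harmonic sum is at least `log z / (2 a)`. The omitted indices below `m₀` cost at most `m₀`,
  -- which is at most half of this as soon as `log z ≥ 4 a m₀`.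
  · obtain ⟨Z₁, hZ₁, hl₁⟩ := exists_log_ge (4 * a * m₀)
    have hZ2 : 1 < max (Z ^ 2) Z₁ := lt_max_of_lt_right hZ₁
    refine ⟨c * (1 / 2) ^ j * (1 / (4 * a)), max (Z ^ 2) Z₁, by positivity, hZ2, fun z hz => ?_⟩
    have hzZ : Z ^ 2 ≤ z := (le_max_left _ _).trans hz
    have hz1 : 1 < z := hZ2.trans_le hz
    have hz0 : 0 < z := by linarith
    have hlog := hl₁ z ((le_max_right _ _).trans hz)
    have hlog0 : 0 ≤ Real.log z := Real.log_nonneg hz1.le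
    rw [if_pos hba]
    set w := z ^ (1 / (2 * a)) with hw
    have hw0 : 0 < w := Real.rpow_pos_of_pos hz0 _
    have hwa : (w ^ a) ^ 2 = z := by
      rw [hw, ← Real.rpow_mul hz0.le, ← Real.rpow_natCast, ← Real.rpow_mul hz0.le]
      rw [show 1 / (2 * a) * a * ((2 : ℕ) : ℝ) = 1 by push_cast; field_simp, Real.rpow_one]
    set K := c * (1 / 2) ^ j * z ^ r * Real.log z ^ j with hK
    have hK0 : 0 ≤ K := by positivity
    refine le_trans ?_ (ofReal_sum_le_tsum_pnat (f := fun m => K * (m : ℝ)⁻¹)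
      (fun m => by positivity) ((Finset.range ⌊w⌋₊).image Nat.succ |>.filter (fun m => (m₀ : ℕ) ≤ m))
      (fun m hm => by
        obtain ⟨x, _, rfl⟩ := Finset.mem_image.1 (Finset.mem_filter.1 hm).1
        omega) _ ?_)
    · refine ENNReal.ofReal_le_ofReal ?_
      rw [← Finset.mul_sum]
      have hsum : 1 / (4 * a) * Real.log z ≤
          ∑ m ∈ ((Finset.range ⌊w⌋₊).image Nat.succ).filter (fun m => (m₀ : ℕ) ≤ m), (m : ℝ)⁻¹ := by
        have hH := log_le_harmonic_floor w hw0.le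
        have hHe : ((harmonic ⌊w⌋₊ : ℚ) : ℝ) = ∑ m ∈ (Finset.range ⌊w⌋₊).image Nat.succ, (m : ℝ)⁻¹ := by
          rw [Finset.sum_image (fun x _ y _ h => Nat.succ_injective h)]
          simp [harmonic]
        rw [hHe, ← Finset.sum_filter_add_sum_filter_not _ (fun m => (m₀ : ℕ) ≤ m)] at hH
        have hrest : ∑ m ∈ ((Finset.range ⌊w⌋₊).image Nat.succ).filter (fun m => ¬ (m₀ : ℕ) ≤ m),
            (m : ℝ)⁻¹ ≤ m₀ := by
          calc _ ≤ ∑ m ∈ ((Finset.range ⌊w⌋₊).image Nat.succ).filter (fun m => ¬ (m₀ : ℕ) ≤ m),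
                (1 : ℝ) := by
                refine Finset.sum_le_sum fun m hm => ?_
                obtain ⟨x, _, rfl⟩ := Finset.mem_image.1 (Finset.mem_filter.1 hm).1
                exact inv_le_one_of_one_le₀ (by push_cast; linarith [x.cast_nonneg (α := ℝ)])
            _ ≤ m₀ := by
                rw [Finset.sum_const, nsmul_eq_mul, mul_one]
                have : (((Finset.range ⌊w⌋₊).image Nat.succ).filter
                    (fun m => ¬ (m₀ : ℕ) ≤ m)).card ≤ (Finset.range (m₀ : ℕ)).card := by
                  refine Finset.card_le_card fun m hm => ?_
                  have := (Finset.mem_filter.1 hm).2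
                  exact Finset.mem_range.2 (by omega)
                rw [Finset.card_range] at this
                exact_mod_cast this
        rw [hw, Real.log_rpow hz0] at hH
        have e : 1 / (2 * a) * Real.log z = 2 * (1 / (4 * a) * Real.log z) := by
          field_simp; ring
        have e2 : (m₀ : ℝ) ≤ 1 / (4 * a) * Real.log z := by
          rw [one_div, inv_mul_eq_div, le_div_iff₀ (by positivity)]; linarith
        rw [hw]
        linarith
      calc c * (1 / 2) ^ j * (1 / (4 * a)) * z ^ r * Real.log z ^ (j + 1)
          = K * (1 / (4 * a) * Real.log z) := by rw [hK]; ring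
        _ ≤ _ := mul_le_mul_of_nonneg_left hsum hK0
    · intro m hm
      obtain ⟨h1, h2⟩ := Finset.mem_filter.1 hm
      obtain ⟨x, hx, hxm⟩ := Finset.mem_image.1 h1
      have hmw : ((m : ℕ) : ℝ) ≤ w := by
        rw [← hxm]
        exact (Nat.le_floor_iff hw0.le).1 (Finset.mem_range.1 hx)
      rw [if_pos (show m₀ ≤ m from h2)]
      refine le_trans (le_of_eq ?_) (term m z hzZ ?_)
      · rw [hba, show a * r - 1 - a * r = -1 by ring, Real.rpow_neg_one]
      · rw [← hwa]
        have := (coe_pnat_pos m).le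
        gcongr
  · have hM : 1 ≤ ((m₀ : ℕ) : ℝ) ^ a := Real.one_le_rpow hm₀ ha.le
    refine ⟨c * (1 / 2) ^ j * ((m₀ : ℕ) : ℝ) ^ (b - 1 - a * r),
      max (Z ^ 2) ((((m₀ : ℕ) : ℝ) ^ a) ^ 2), by positivity,
      lt_max_of_lt_left (by nlinarith), fun z hz => ?_⟩
    refine le_trans ?_ (ENNReal.le_tsum m₀)
    rw [if_neg hba, if_pos le_rfl]
    refine le_trans (le_of_eq ?_) (term m₀ z ((le_max_left _ _).trans hz)
      ((le_max_right _ _).trans hz))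
    congr 1; ring

lemma cons_le_iff {k : ℕ} (n₀ : Lattice (k + 1)) (m : ℕ+) (n : Lattice k) :
    n₀ ≤ (Fin.cons m n : Lattice (k + 1)) ↔ n₀ 0 ≤ m ∧ (fun i => n₀ i.succ) ≤ n := by
  simp [Pi.le_def, Fin.forall_fin_succ]

open Classical in
lemma le_tsum_lattice {r b : ℝ} {k : ℕ} (α : Fin k → ℝ)
    (hα : ∀ i, 0 < α i) (n₀ : Lattice k) (j : ℕ) (F : ℝ → ENNReal) {c Z : ℝ} (hc : 0 < c)
    (hZ : 1 < Z) (hF : ∀ z, Z ≤ z → ENNReal.ofReal (c * z ^ r * Real.log z ^ j) ≤ F z) :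
    ∃ c' Z' : ℝ, 0 < c' ∧ 1 < Z' ∧ ∀ z, Z' ≤ z →
      ENNReal.ofReal (c' * z ^ r * Real.log z ^
          (j + (Finset.univ.filter fun i => b = α i * r).card)) ≤
      ∑' n : Lattice k, if n₀ ≤ n then
        ENNReal.ofReal (size n ^ (b - 1)) * F (z / sizePow α n) else 0 := by
  induction k with
  | zero =>
    refine ⟨c, Z, hc, hZ, fun z hz => ?_⟩
    have hn : ∀ n : Lattice 0, n₀ ≤ n := fun n => (Subsingleton.elim n₀ n).le
    rw [tsum_fintype, Fintype.sum_unique]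
    simpa [size, sizePow, hn] using hF z hz
  | succ k ih =>
    obtain ⟨c₁, Z₁, hc₁, hZ₁, h₁⟩ := ih (fun i => α i.succ) (fun i => hα i.succ)
      (fun i => n₀ i.succ)
    obtain ⟨c₂, Z₂, hc₂, hZ₂, h₂⟩ := le_tsum_step (b := b) (hα 0) (n₀ 0) _ _ hc₁ hZ₁ h₁
    refine ⟨c₂, Z₂, hc₂, hZ₂, fun z hz => ?_⟩
    have hcard : j + (Finset.univ.filter fun i => b = α i * r).card =
        if b = α 0 * r then j + (Finset.univ.filter fun i : Fin k => b = α i.succ * r).card + 1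
        else j + (Finset.univ.filter fun i : Fin k => b = α i.succ * r).card := by
      rw [Fin.card_filter_univ_succ]
      split_ifs
      · ring
      · rfl
    rw [hcard]
    refine (h₂ z hz).trans (le_of_eq ?_)
    rw [tsum_lattice_succ]
    refine tsum_congr fun m => ?_
    have hm := coe_pnat_pos m
    split_ifs with hmm
    · rw [← ENNReal.tsum_mul_left]
      refine tsum_congr fun n => ?_
      simp only [cons_le_iff, hmm, true_and, mul_ite, mul_zero]
      rw [size_cons, sizePow_cons, Real.mul_rpow hm.le (size_pos n).le,
        ENNReal.ofReal_mul (by positivity), mul_assoc, div_div]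
    · simp [cons_le_iff, hmm]

open Classical in
/-- The lower bound for the weighted count of lattice points. -/
theorem le_tsum_lattice_lt {r a : ℝ} (ha : 0 < a) (har : 1 ≤ a * r) {k : ℕ}
    (α : Fin (k + 1) → ℝ) (h0 : α 0 = a) (hα : ∀ i, a ≤ α i) (n₀ : Lattice (k + 1)) :
    ∃ c Z : ℝ, 0 < c ∧ 1 < Z ∧ ∀ z, Z ≤ z →
      ENNReal.ofReal (c * z ^ r * Real.log z ^
        ((Finset.univ.filter fun i : Fin k => α i.succ = a).card)) ≤
      ∑' n : Lattice (k + 1), if n₀ ≤ n ∧ sizePow α n < z then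
        ENNReal.ofReal (size n ^ (a * r - 1)) else 0 := by
  have hr : 0 < r := by by_contra h; nlinarith
  obtain ⟨c₁, Z₁, hc₁, hZ₁, h₁⟩ := le_tsum_base ha har (n₀ 0)
  obtain ⟨c, Z, hc, hZ, h⟩ := le_tsum_lattice (b := a * r) (fun i : Fin k => α i.succ)
    (fun i => ha.trans_le (hα _)) (fun i => n₀ i.succ) 0 _ hc₁ hZ₁
    (fun z hz => by simpa only [pow_zero, mul_one] using h₁ z hz)
  refine ⟨c, Z, hc, hZ, fun z hz => ?_⟩
  have hcard : (Finset.univ.filter fun i : Fin k => α i.succ = a).card =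
      0 + (Finset.univ.filter fun i : Fin k => a * r = α i.succ * r).card := by
    rw [zero_add]
    congr 1
    ext i
    simp only [Finset.mem_filter, Finset.mem_univ, true_and, mul_left_inj' hr.ne', eq_comm]
  rw [hcard]
  refine (h z hz).trans (le_of_eq ?_)
  rw [tsum_lattice_succ, ENNReal.tsum_comm]
  refine tsum_congr fun n => ?_
  have hn := size_pos n
  have hs := sizePow_pos (fun i => α i.succ) n
  by_cases hnn : (fun i => n₀ i.succ) ≤ n
  · rw [if_pos hnn, ← ENNReal.tsum_mul_left]
    refine tsum_congr fun m => ?_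
    have hm := coe_pnat_pos m
    simp only [cons_le_iff, hnn, and_true, sizePow_cons, h0, lt_div_iff₀ hs, size_cons]
    split_ifs
    · rw [Real.mul_rpow hm.le hn.le, ← ENNReal.ofReal_mul (by positivity), mul_comm]
    · simp
  · simp [cons_le_iff, hnn]

/-! ### Exponential moments under negative dependence -/

section NegativeDependence

variable {ι Ω : Type*} [MeasurableSpace Ω]

/-- Each factor is a layer-cake integral of indicators. Tonelli takes the integrals out one at a
time, until only the probability of an intersection of level sets is left, to which the hypothesis
applies. -/
lemma lintegral_prod_indicator_le (P : Measure Ω) [IsProbabilityMeasure P]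
    (A : ι → ℝ → Set Ω) (hA : ∀ j, MeasurableSet {p : ℝ × Ω | p.2 ∈ A j p.1})
    (h : ∀ (s : Finset ι) (u : ι → ℝ), P (⋂ j ∈ s, A j (u j)) ≤ ∏ j ∈ s, P (A j (u j)))
    (s : Finset ι) :
    ∫⁻ ω, ∏ j ∈ s, (∫⁻ u in Set.Ioi (0 : ℝ), (A j u).indicator 1 ω) ∂P ≤
      ∏ j ∈ s, ∫⁻ u in Set.Ioi (0 : ℝ), P (A j u) := by
  classical
  have hAu : ∀ j u, MeasurableSet (A j u) := fun j u =>
    (measurable_prodMk_left (x := u)) (hA j)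
  have hmeas : ∀ j, Measurable fun p : ℝ × Ω => (A j p.1).indicator (1 : Ω → ENNReal) p.2 := by
    intro j
    have : (fun p : ℝ × Ω => (A j p.1).indicator (1 : Ω → ENNReal) p.2) =
        ({p : ℝ × Ω | p.2 ∈ A j p.1}).indicator 1 := by
      ext p; simp [Set.indicator_apply]
    rw [this]
    exact measurable_one.indicator (hA j)
  have hZ : ∀ j, Measurable fun ω => ∫⁻ u in Set.Ioi (0 : ℝ), (A j u).indicator (1 : Ω → ENNReal) ω :=
    fun j => (hmeas j).lintegral_prod_left'
  have hPA : ∀ j, Measurable fun u => P (A j u) := fun j => measurable_measure_prodMk_left (hA j)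
  -- The induction carries the indicator of the levels already fixed on `B`; each step moves one
  -- index from `s` to `B`.
  have main : ∀ (s B : Finset ι) (_ : Disjoint s B) (v : ι → ℝ),
      ∫⁻ ω, (∏ j ∈ s, (∫⁻ u in Set.Ioi (0 : ℝ), (A j u).indicator 1 ω)) *
        (⋂ j ∈ B, A j (v j)).indicator 1 ω ∂P ≤
      (∏ j ∈ s, ∫⁻ u in Set.Ioi (0 : ℝ), P (A j u)) * ∏ j ∈ B, P (A j (v j)) := by
    intro s
    induction s using Finset.induction_on with
    | empty =>
      intro B _ v
      simp only [Finset.prod_empty, one_mul]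
      rw [lintegral_indicator_one (Finset.measurableSet_biInter _ fun j _ => hAu j _)]
      exact h B v
    | insert a s ha ih =>
      intro B hB v
      have haB : a ∉ B := Finset.disjoint_left.1 hB (Finset.mem_insert_self a s)
      have hsB : Disjoint s (insert a B) := by
        rw [Finset.disjoint_insert_right]
        exact ⟨ha, Finset.disjoint_of_subset_left (Finset.subset_insert a s) hB⟩
      have hW : Measurable fun ω => (∏ j ∈ s, (∫⁻ u in Set.Ioi (0 : ℝ), (A j u).indicator (1 : Ω → ENNReal) ω)) *
          (⋂ j ∈ B, A j (v j)).indicator 1 ω :=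
        (Finset.measurable_prod _ fun j _ => hZ j).mul
          (measurable_one.indicator (Finset.measurableSet_biInter _ fun j _ => hAu j _))
      calc ∫⁻ ω, (∏ j ∈ insert a s, (∫⁻ u in Set.Ioi (0 : ℝ), (A j u).indicator 1 ω)) *
            (⋂ j ∈ B, A j (v j)).indicator 1 ω ∂P
          = ∫⁻ ω, (∫⁻ u in Set.Ioi (0 : ℝ), (A a u).indicator 1 ω *
              ((∏ j ∈ s, (∫⁻ u in Set.Ioi (0 : ℝ), (A j u).indicator 1 ω)) *
                (⋂ j ∈ B, A j (v j)).indicator 1 ω)) ∂P := by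
            refine lintegral_congr fun ω => ?_
            rw [Finset.prod_insert ha, mul_assoc, lintegral_mul_const]
            exact (hmeas a).comp measurable_prodMk_right
        _ = ∫⁻ u in Set.Ioi (0 : ℝ), ∫⁻ ω, (A a u).indicator 1 ω *
              ((∏ j ∈ s, (∫⁻ u in Set.Ioi (0 : ℝ), (A j u).indicator 1 ω)) *
                (⋂ j ∈ B, A j (v j)).indicator 1 ω) ∂P := by
            refine lintegral_lintegral_swap (Measurable.aemeasurable ?_)
            exact ((hmeas a).comp measurable_swap).mul (hW.comp measurable_fst)
        _ ≤ ∫⁻ u in Set.Ioi (0 : ℝ), P (A a u) * ((∏ j ∈ s, ∫⁻ u in Set.Ioi (0 : ℝ), P (A j u)) *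
              ∏ j ∈ B, P (A j (v j))) := by
            refine lintegral_mono fun u => ?_
            have hB' : ∀ j ∈ B, Function.update v a u j = v j := fun j hj =>
              Function.update_of_ne (by rintro rfl; exact haB hj) _ _
            have := ih (insert a B) hsB (Function.update v a u)
            have e1 : ∏ j ∈ B, P (A j (Function.update v a u j)) = ∏ j ∈ B, P (A j (v j)) :=
              Finset.prod_congr rfl fun j hj => by rw [hB' j hj]
            have e2 : ⋂ j ∈ B, A j (Function.update v a u j) = ⋂ j ∈ B, A j (v j) :=
              Set.iInter₂_congr fun j hj => by rw [hB' j hj]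
            rw [Finset.prod_insert haB, Function.update_self, e1] at this
            refine le_trans (le_of_eq ?_) (this.trans_eq (by ring))
            refine lintegral_congr fun ω => ?_
            rw [Finset.set_biInter_insert, Function.update_self, e2, Set.inter_indicator_one,
              Pi.mul_apply]
            ring
        _ = _ := by
            rw [lintegral_mul_const _ (hPA a), Finset.prod_insert ha, mul_assoc]
  simpa using main s ∅ (Finset.disjoint_empty_right s) 0

/-- Level sets of a clipped variable can degenerate. The whole space contributes a factor `1` and
can be dropped; an empty set makes the left side zero. -/
lemma measure_biInter_le_prod (P : Measure Ω) [IsProbabilityMeasure P] (E : ι → ℝ → Set Ω)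
    (hE : ∀ (s : Finset ι) (x : ι → ℝ), P.real (⋂ j ∈ s, E j (x j)) ≤ ∏ j ∈ s, P.real (E j (x j)))
    (A : ι → Set Ω) (hA : ∀ j, A j = Set.univ ∨ A j = ∅ ∨ ∃ x, A j = E j x) (s : Finset ι) :
    P (⋂ j ∈ s, A j) ≤ ∏ j ∈ s, P (A j) := by
  classical
  by_cases hempty : ∃ j ∈ s, A j = ∅
  · obtain ⟨j, hj, hje⟩ := hempty
    have : ⋂ j ∈ s, A j = ∅ := by
      refine Set.subset_empty_iff.1 ?_
      rw [← hje]
      exact Set.biInter_subset_of_mem hj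
    rw [this, measure_empty]
    exact zero_le
  push Not at hempty
  have hx : ∀ j, ∃ x, j ∈ s → A j ≠ Set.univ → A j = E j x := by
    intro j
    rcases hA j with h | h | ⟨x, h⟩
    · exact ⟨0, fun _ h' => absurd h h'⟩
    · exact ⟨0, fun hj => absurd h (hempty j hj).ne_empty⟩
    · exact ⟨x, fun _ _ => h⟩
  choose x hx using hx
  set t := s.filter fun j => A j ≠ Set.univ with ht
  have hts : ∀ j ∈ t, A j = E j (x j) := fun j hj =>
    hx j (Finset.mem_filter.1 hj).1 (Finset.mem_filter.1 hj).2
  have h1 : ⋂ j ∈ s, A j = ⋂ j ∈ t, E j (x j) := by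
    ext ω
    simp only [Set.mem_iInter]
    refine ⟨fun h j hj => hts j hj ▸ h j (Finset.mem_filter.1 hj).1, fun h j hj => ?_⟩
    by_cases hu : A j = Set.univ
    · rw [hu]; trivial
    · have hjt : j ∈ t := Finset.mem_filter.2 ⟨hj, hu⟩
      rw [hts j hjt]; exact h j hjt
  have h2 : ∏ j ∈ s, P (A j) = ∏ j ∈ t, P (E j (x j)) := by
    rw [← Finset.prod_filter_mul_prod_filter_not s fun j => A j ≠ Set.univ]
    rw [Finset.prod_congr rfl (g := fun _ => (1 : ENNReal)) (s₁ := s.filter fun j => ¬ A j ≠ Set.univ),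
      Finset.prod_const_one, mul_one]
    · exact Finset.prod_congr rfl fun j hj => by rw [hts j hj]
    · intro j hj
      rw [not_not.1 (Finset.mem_filter.1 hj).2, measure_univ]
  rw [h1, h2, ← ofReal_measureReal, Finset.prod_congr rfl fun j _ => (ofReal_measureReal (μ := P) (s := E j (x j))).symm,
    ← ENNReal.ofReal_prod_of_nonneg fun j _ => measureReal_nonneg]
  exact ENNReal.ofReal_le_ofReal (hE t x)

/-- Truncation at levels `-y` and `y`. -/
noncomputable def clip (y x : ℝ) : ℝ := max (min x y) (-y)

lemma measurable_clip (y : ℝ) : Measurable (clip y) :=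
  (measurable_id.min measurable_const).max measurable_const

lemma abs_clip_le {y : ℝ} (hy : 0 ≤ y) (x : ℝ) : |clip y x| ≤ y := by
  unfold clip
  exact abs_le.2 ⟨le_max_right _ _, max_le (min_le_right _ _) (by linarith)⟩

lemma clip_of_abs_le {x y : ℝ} (h : |x| ≤ y) : clip y x = x := by
  unfold clip
  rw [min_eq_left (abs_le.1 h).2, max_eq_left (abs_le.1 h).1]

lemma abs_clip {y : ℝ} (hy : 0 ≤ y) (x : ℝ) : |clip y x| = min |x| y := by
  unfold clip
  rcases le_total |x| y with h | h
  · rw [min_eq_left (abs_le.1 h).2, max_eq_left (abs_le.1 h).1, min_eq_left h]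
  · rw [min_eq_right h]
    rcases le_abs.1 h with h' | h'
    · rw [min_eq_right h', max_eq_left (by linarith), abs_of_nonneg hy]
    · rw [min_eq_left (by linarith), max_eq_right (by linarith), abs_neg, abs_of_nonneg hy]

lemma abs_clip_sub {y : ℝ} (hy : 0 ≤ y) (x : ℝ) : |clip y x - x| = max (|x| - y) 0 := by
  rcases le_total |x| y with h | h
  · rw [clip_of_abs_le h, sub_self, abs_zero, max_eq_right (by linarith)]
  · rw [max_eq_left (by linarith)]
    unfold clip
    rcases le_total 0 x with h0 | h0
    · rw [abs_of_nonneg h0] at h ⊢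
      rw [min_eq_right h, max_eq_left (by linarith), abs_sub_comm, abs_of_nonneg (by linarith)]
    · rw [abs_of_nonpos h0] at h ⊢
      rw [min_eq_left (by linarith), max_eq_right (by linarith), abs_of_nonneg (by linarith)]
      ring

lemma lintegral_indicator_lt (c : ℝ) :
    ∫⁻ u in Set.Ioi (0 : ℝ), (if u < c then 1 else 0 : ENNReal) = ENNReal.ofReal c := by
  have : (fun u : ℝ => (if u < c then 1 else 0 : ENNReal)) = (Set.Iio c).indicator 1 := by
    ext u; simp [Set.indicator_apply]
  rw [this, lintegral_indicator_one measurableSet_Iio, Measure.restrict_apply measurableSet_Iio,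
    Set.inter_comm, Set.Ioi_inter_Iio, Real.volume_Ioo, sub_zero]

lemma lintegral_indicator_le (c : ℝ) :
    ∫⁻ u in Set.Ioi (0 : ℝ), (if u ≤ c then 1 else 0 : ENNReal) = ENNReal.ofReal c := by
  have : (fun u : ℝ => (if u ≤ c then 1 else 0 : ENNReal)) = (Set.Iic c).indicator 1 := by
    ext u; simp [Set.indicator_apply]
  rw [this, lintegral_indicator_one measurableSet_Iic, Measure.restrict_apply measurableSet_Iic,
    Set.inter_comm, Set.Ioi_inter_Iic, Real.volume_Ioc, sub_zero]

variable {P : Measure Ω} [IsProbabilityMeasure P] {X : ι → Ω → ℝ}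

/-- Clipping is nondecreasing, unlike truncation to zero, so the superlevel sets of `exp (t * clip y
X)` are of the form `{v < X}` or trivial, and the upper orthant inequality applies. -/
lemma NegDependent.lintegral_exp_clip_le (hX : NegDependent X P) (hm : ∀ j, Measurable (X j))
    (y : ℝ) {t : ℝ} (ht : 0 < t) (s : Finset ι) :
    ∫⁻ ω, ∏ j ∈ s, ENNReal.ofReal (Real.exp (t * clip y (X j ω))) ∂P ≤
      ∏ j ∈ s, ∫⁻ ω, ENNReal.ofReal (Real.exp (t * clip y (X j ω))) ∂P := by
  have hY : ∀ j, Measurable fun ω => Real.exp (t * clip y (X j ω)) := fun j =>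
    (((measurable_clip y).comp (hm j)).const_mul t).exp
  set A : ι → ℝ → Set Ω := fun j u => {ω | u < Real.exp (t * clip y (X j ω))} with hA
  have hAm : ∀ j, MeasurableSet {p : ℝ × Ω | p.2 ∈ A j p.1} := fun j =>
    measurableSet_lt measurable_fst ((hY j).comp measurable_snd)
  have hint : ∀ j ω, ∫⁻ u in Set.Ioi (0 : ℝ), (A j u).indicator (1 : Ω → ENNReal) ω =
      ENNReal.ofReal (Real.exp (t * clip y (X j ω))) := by
    intro j ω
    rw [← lintegral_indicator_lt]
    refine lintegral_congr fun u => ?_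
    simp [A, Set.indicator_apply]
  have hint' : ∀ j, ∫⁻ u in Set.Ioi (0 : ℝ), P (A j u) =
      ∫⁻ ω, ENNReal.ofReal (Real.exp (t * clip y (X j ω))) ∂P := by
    intro j
    simp_rw [← hint j]
    rw [lintegral_lintegral_swap]
    · refine lintegral_congr fun u => ?_
      rw [lintegral_indicator_one (measurableSet_lt measurable_const (hY j))]
    · have : (Function.uncurry fun (ω : Ω) (u : ℝ) => (A j u).indicator (1 : Ω → ENNReal) ω) =
          ({p : ℝ × Ω | p.2 ∈ A j p.1}).indicator 1 ∘ Prod.swap := by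
        ext p; simp [Set.indicator_apply, Function.uncurry]
      rw [this]
      exact ((measurable_one.indicator (hAm j)).comp measurable_swap).aemeasurable
  have key := lintegral_prod_indicator_le P A hAm (fun s u => by
    refine measure_biInter_le_prod P (fun j x => {ω | x < X j ω}) (fun s x => (hX s x).2)
      (fun j => A j (u j)) (fun j => ?_) s
    by_cases hu : 0 < u j
    · have h1 : A j (u j) = {ω | Real.log (u j) / t < clip y (X j ω)} := by
        ext ω
        simp only [A, Set.mem_ofPred_eq]
        rw [← Real.log_lt_iff_lt_exp hu, div_lt_iff₀ ht, mul_comm]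
      set v := Real.log (u j) / t
      rw [h1]
      by_cases hv : v < -y
      · left
        ext ω
        simp [clip, hv]
      · by_cases hv' : v < y
        · right; right
          exact ⟨v, by ext ω; simp [clip, hv, hv']⟩
        · right; left
          ext ω
          simp [clip, hv, hv']
    · left
      ext ω
      simp only [A, Set.mem_ofPred_eq, Set.mem_univ, iff_true]
      exact (not_lt.1 hu).trans_lt (Real.exp_pos _)) s
  simpa only [hint, hint'] using key

lemma NegDependent.lintegral_exp_neg_clip_le (hX : NegDependent X P) (hm : ∀ j, Measurable (X j))
    (y : ℝ) {t : ℝ} (ht : 0 < t) (s : Finset ι) :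
    ∫⁻ ω, ∏ j ∈ s, ENNReal.ofReal (Real.exp (t * -clip y (X j ω))) ∂P ≤
      ∏ j ∈ s, ∫⁻ ω, ENNReal.ofReal (Real.exp (t * -clip y (X j ω))) ∂P := by
  have hY : ∀ j, Measurable fun ω => Real.exp (t * -clip y (X j ω)) := fun j =>
    (((measurable_clip y).comp (hm j)).neg.const_mul t).exp
  -- The inequality is not strict here, so that the level sets become `{X ≤ v}`, as in the lower
  -- orthant inequality.
  set A : ι → ℝ → Set Ω := fun j u => {ω | u ≤ Real.exp (t * -clip y (X j ω))} with hA
  have hAm : ∀ j, MeasurableSet {p : ℝ × Ω | p.2 ∈ A j p.1} := fun j =>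
    measurableSet_le measurable_fst ((hY j).comp measurable_snd)
  have hint : ∀ j ω, ∫⁻ u in Set.Ioi (0 : ℝ), (A j u).indicator (1 : Ω → ENNReal) ω =
      ENNReal.ofReal (Real.exp (t * -clip y (X j ω))) := by
    intro j ω
    rw [← lintegral_indicator_le]
    refine lintegral_congr fun u => ?_
    simp [A, Set.indicator_apply]
  have hint' : ∀ j, ∫⁻ u in Set.Ioi (0 : ℝ), P (A j u) =
      ∫⁻ ω, ENNReal.ofReal (Real.exp (t * -clip y (X j ω))) ∂P := by
    intro j
    simp_rw [← hint j]
    rw [lintegral_lintegral_swap]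
    · refine lintegral_congr fun u => ?_
      rw [lintegral_indicator_one (measurableSet_le measurable_const (hY j))]
    · have : (Function.uncurry fun (ω : Ω) (u : ℝ) => (A j u).indicator (1 : Ω → ENNReal) ω) =
          ({p : ℝ × Ω | p.2 ∈ A j p.1}).indicator 1 ∘ Prod.swap := by
        ext p; simp [Set.indicator_apply, Function.uncurry]
      rw [this]
      exact ((measurable_one.indicator (hAm j)).comp measurable_swap).aemeasurable
  have key := lintegral_prod_indicator_le P A hAm (fun s u => by
    refine measure_biInter_le_prod P (fun j x => {ω | X j ω ≤ x}) (fun s x => (hX s x).1)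
      (fun j => A j (u j)) (fun j => ?_) s
    by_cases hu : 0 < u j
    · have h1 : A j (u j) = {ω | clip y (X j ω) ≤ -(Real.log (u j) / t)} := by
        ext ω
        simp only [A, Set.mem_ofPred_eq]
        rw [← Real.log_le_iff_le_exp hu, le_neg, div_le_iff₀ ht, mul_comm]
      set v := -(Real.log (u j) / t)
      rw [h1]
      by_cases hv : -y ≤ v
      · by_cases hv' : y ≤ v
        · left
          ext ω
          simp only [clip, Set.mem_ofPred_eq, max_le_iff, min_le_iff, hv, hv', or_true, and_true,
            Set.mem_univ]
        · right; right
          exact ⟨v, by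
            ext ω
            simp only [clip, Set.mem_ofPred_eq, max_le_iff, min_le_iff, hv, hv', or_false, and_true]⟩
      · right; left
        ext ω
        simp only [clip, Set.mem_ofPred_eq, max_le_iff, hv, and_false, Set.mem_empty_iff_false]
    · left
      ext ω
      simp only [A, Set.mem_ofPred_eq, Set.mem_univ, iff_true]
      exact (not_lt.1 hu).trans (Real.exp_pos _).le) s
  simpa only [hint, hint'] using key

end NegativeDependence

/-! ### A Fuk–Nagaev inequality -/

/-- Termwise comparison of the series `∑ x ^ (k + 2) / (k + 2)!` at `u` and `c`, since `u ^ k ≤ c ^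
k`. -/
lemma exp_sub_one_sub_mul_sq_le {u c : ℝ} (h : |u| ≤ c) :
    c ^ 2 * (Real.exp u - 1 - u) ≤ u ^ 2 * (Real.exp c - 1 - c) := by
  have hs : ∀ x : ℝ, HasSum (fun k : ℕ => x ^ (k + 2) / ((k + 2).factorial : ℝ))
      (Real.exp x - 1 - x) := by
    intro x
    have h1 : HasSum (fun k : ℕ => x ^ k / (k.factorial : ℝ)) (Real.exp x) := by
      rw [Real.exp_eq_exp_ℝ]
      exact NormedSpace.expSeries_div_hasSum_exp x
    have h2 := (hasSum_nat_add_iff' 2).2 h1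
    simpa [Finset.sum_range_succ, sub_sub] using h2
  have hc : 0 ≤ c := (abs_nonneg u).trans h
  refine hasSum_le (fun k => ?_) ((hs u).mul_left (c ^ 2)) ((hs c).mul_left (u ^ 2))
  have h1 : u ^ k ≤ c ^ k := (le_abs_self _).trans (by
    rw [abs_pow]; exact pow_le_pow_left₀ (abs_nonneg u) h k)
  have h2 : c ^ 2 * (u ^ (k + 2)) ≤ u ^ 2 * c ^ (k + 2) := by
    have := mul_le_mul_of_nonneg_left h1 (show 0 ≤ c ^ 2 * u ^ 2 by positivity)
    calc c ^ 2 * (u ^ (k + 2)) = c ^ 2 * u ^ 2 * u ^ k := by ring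
      _ ≤ _ := this
      _ = _ := by ring
  rw [← mul_div_assoc, ← mul_div_assoc]
  exact div_le_div_of_nonneg_right h2 (by positivity)

/-- Bernstein's step: `exp (tY) ≤ 1 + tY + (exp (ty) / y²) Y²` pointwise, where the factor `t²`
cancels; integration and `1 + v ≤ exp v` finish. -/
lemma integral_exp_le {Ω : Type*} [MeasurableSpace Ω] {P : Measure Ω} [IsProbabilityMeasure P]
    {Y : Ω → ℝ} (hY : Measurable Y) {y t : ℝ} (hy : 0 < y) (ht : 0 < t) (hb : ∀ ω, |Y ω| ≤ y) :
    ∫⁻ ω, ENNReal.ofReal (Real.exp (t * Y ω)) ∂P ≤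
      ENNReal.ofReal (Real.exp (t * ∫ ω, Y ω ∂P + Real.exp (t * y) / y ^ 2 * ∫ ω, Y ω ^ 2 ∂P)) := by
  have hYi : Integrable Y P := Integrable.of_bound hY.aestronglyMeasurable y
    (Filter.Eventually.of_forall fun ω => hb ω)
  have hY2 : Integrable (fun ω => Y ω ^ 2) P := Integrable.of_bound
    (hY.pow_const 2).aestronglyMeasurable (y ^ 2) (Filter.Eventually.of_forall fun ω => by
      rw [Real.norm_eq_abs, abs_pow]
      exact pow_le_pow_left₀ (abs_nonneg _) (hb ω) 2)
  have hpt : ∀ ω, Real.exp (t * Y ω) ≤ 1 + t * Y ω + Real.exp (t * y) / y ^ 2 * Y ω ^ 2 := by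
    intro ω
    have h1 : |t * Y ω| ≤ t * y := by
      rw [abs_mul, abs_of_pos ht]; exact mul_le_mul_of_nonneg_left (hb ω) ht.le
    have h2 := exp_sub_one_sub_mul_sq_le h1
    have hty : 0 < t * y := by positivity
    have h3 : (t * Y ω) ^ 2 * (Real.exp (t * y) - 1 - t * y) ≤ (t * Y ω) ^ 2 * Real.exp (t * y) :=
      mul_le_mul_of_nonneg_left (by linarith) (by positivity)
    have h4 : Real.exp (t * Y ω) - 1 - t * Y ω ≤ (t * Y ω) ^ 2 * Real.exp (t * y) / (t * y) ^ 2 := by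
      rw [le_div_iff₀ (by positivity), mul_comm]
      exact h2.trans h3
    have h5 : (t * Y ω) ^ 2 * Real.exp (t * y) / (t * y) ^ 2 =
        Real.exp (t * y) / y ^ 2 * Y ω ^ 2 := by
      field_simp
    linarith
  have hi : Integrable (fun ω => 1 + t * Y ω + Real.exp (t * y) / y ^ 2 * Y ω ^ 2) P :=
    ((integrable_const _).add (hYi.const_mul t)).add (hY2.const_mul _)
  calc ∫⁻ ω, ENNReal.ofReal (Real.exp (t * Y ω)) ∂P
      ≤ ∫⁻ ω, ENNReal.ofReal (1 + t * Y ω + Real.exp (t * y) / y ^ 2 * Y ω ^ 2) ∂P :=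
        lintegral_mono fun ω => ENNReal.ofReal_le_ofReal (hpt ω)
    _ = ENNReal.ofReal (∫ ω, (1 + t * Y ω + Real.exp (t * y) / y ^ 2 * Y ω ^ 2) ∂P) :=
        (ofReal_integral_eq_lintegral_ofReal hi (Filter.Eventually.of_forall fun ω =>
          (Real.exp_pos _).le.trans (hpt ω))).symm
    _ ≤ _ := by
        refine ENNReal.ofReal_le_ofReal ?_
        have e : ∫ ω, (1 + t * Y ω + Real.exp (t * y) / y ^ 2 * Y ω ^ 2) ∂P =
            ∫ ω, (1 + t * Y ω) ∂P + ∫ ω, Real.exp (t * y) / y ^ 2 * Y ω ^ 2 ∂P :=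
          integral_add ((integrable_const _).add (hYi.const_mul t)) (hY2.const_mul _)
        rw [e, integral_add (integrable_const _) (hYi.const_mul t), integral_const_mul,
          integral_const_mul, integral_const, probReal_univ, one_smul]
        have := Real.add_one_le_exp (t * ∫ ω, Y ω ∂P + Real.exp (t * y) / y ^ 2 * ∫ ω, Y ω ^ 2 ∂P)
        linarith

/-- A Fuk–Nagaev type bound for sums of bounded variables with submultiplicative exponential
moments. -/
lemma measureReal_sum_gt_le {ι Ω : Type*} [MeasurableSpace Ω] {P : Measure Ω}
    [IsProbabilityMeasure P] {Y : ι → Ω → ℝ} (hY : ∀ j, Measurable (Y j)) {x y B : ℝ} (hx : 0 < x)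
    (hy : 0 < y) (hB : 0 < B) (hb : ∀ j ω, |Y j ω| ≤ y) (s : Finset ι)
    (hexp : ∀ t, 0 < t → ∫⁻ ω, ∏ j ∈ s, ENNReal.ofReal (Real.exp (t * Y j ω)) ∂P ≤
      ∏ j ∈ s, ∫⁻ ω, ENNReal.ofReal (Real.exp (t * Y j ω)) ∂P)
    (hmean : ∑ j ∈ s, ∫ ω, Y j ω ∂P ≤ x / 2) (hvar : ∑ j ∈ s, ∫ ω, Y j ω ^ 2 ∂P ≤ B) :
    P.real {ω | x < ∑ j ∈ s, Y j ω} ≤ Real.exp 1 * (B / y ^ 2) ^ (x / (2 * y)) := by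
  -- If `B ≥ y²`, the asserted bound is at least `1`.
  rcases le_or_gt (y ^ 2) B with hBy | hBy
  · refine measureReal_le_one.trans ?_
    have h1 : 1 ≤ (B / y ^ 2) ^ (x / (2 * y)) :=
      Real.one_le_rpow ((one_le_div₀ (by positivity)).2 hBy) (by positivity)
    have h2 : 1 ≤ Real.exp 1 := Real.one_le_exp zero_le_one
    exact one_le_mul_of_one_le_of_one_le h2 h1
  -- With this `t`, `exp (t y) = y² / B`, so the quadratic terms add up to at most `1`; this is the
  -- factor `exp 1` in the bound.
  set t := Real.log (y ^ 2 / B) / y with ht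
  have hq : 1 < y ^ 2 / B := (one_lt_div₀ hB).2 hBy
  have ht0 : 0 < t := div_pos (Real.log_pos hq) hy
  have hty : Real.exp (t * y) = y ^ 2 / B := by
    rw [ht, div_mul_cancel₀ _ hy.ne', Real.exp_log (by linarith)]
  have h1 : ∫⁻ ω, ENNReal.ofReal (Real.exp (t * ∑ j ∈ s, Y j ω)) ∂P ≤
      ENNReal.ofReal (Real.exp (t * (x / 2) + 1)) := by
    calc ∫⁻ ω, ENNReal.ofReal (Real.exp (t * ∑ j ∈ s, Y j ω)) ∂P
        = ∫⁻ ω, ∏ j ∈ s, ENNReal.ofReal (Real.exp (t * Y j ω)) ∂P := by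
          refine lintegral_congr fun ω => ?_
          rw [Finset.mul_sum, Real.exp_sum, ENNReal.ofReal_prod_of_nonneg fun j _ => (Real.exp_pos _).le]
      _ ≤ _ := hexp t ht0
      _ ≤ ∏ j ∈ s, ENNReal.ofReal (Real.exp (t * ∫ ω, Y j ω ∂P +
            Real.exp (t * y) / y ^ 2 * ∫ ω, Y j ω ^ 2 ∂P)) :=
          Finset.prod_le_prod' fun j _ => integral_exp_le (hY j) hy ht0 (hb j)
      _ ≤ _ := by
          rw [← ENNReal.ofReal_prod_of_nonneg fun j _ => (Real.exp_pos _).le, ← Real.exp_sum,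
            Finset.sum_add_distrib, ← Finset.mul_sum, ← Finset.mul_sum]
          refine ENNReal.ofReal_le_ofReal (Real.exp_le_exp.2 (add_le_add
            (mul_le_mul_of_nonneg_left hmean ht0.le) ?_))
          rw [hty, div_div_cancel_left' (by positivity), inv_mul_le_iff₀ hB, mul_one]
          exact hvar
  have h2 : ENNReal.ofReal (Real.exp (t * x)) * P {ω | x < ∑ j ∈ s, Y j ω} ≤
      ENNReal.ofReal (Real.exp (t * (x / 2) + 1)) := by
    refine le_trans ?_ h1
    have hmeas : Measurable fun ω => ENNReal.ofReal (Real.exp (t * ∑ j ∈ s, Y j ω)) :=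
      ((Finset.measurable_sum s fun j _ => hY j).const_mul t).exp.ennreal_ofReal
    refine le_trans (mul_le_mul_right (measure_mono ?_) _) (mul_meas_ge_le_lintegral hmeas _)
    intro ω hω
    exact ENNReal.ofReal_le_ofReal (Real.exp_le_exp.2 (mul_le_mul_of_nonneg_left (le_of_lt hω) ht0.le))
  have h3 : Real.exp (t * x) * P.real {ω | x < ∑ j ∈ s, Y j ω} ≤ Real.exp (t * (x / 2) + 1) := by
    rw [← ENNReal.ofReal_le_ofReal_iff (Real.exp_pos _).le, ENNReal.ofReal_mul (Real.exp_pos _).le,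
      ofReal_measureReal]
    exact h2
  have h4 : P.real {ω | x < ∑ j ∈ s, Y j ω} ≤ Real.exp (t * (x / 2) + 1) * Real.exp (-(t * x)) := by
    rw [Real.exp_neg, ← div_eq_mul_inv, le_div_iff₀ (Real.exp_pos _), mul_comm]
    exact h3
  refine h4.trans_eq ?_
  rw [← Real.exp_add, Real.rpow_def_of_pos (by positivity), ← Real.exp_add]
  congr 1
  have : Real.log (B / y ^ 2) = -Real.log (y ^ 2 / B) := by
    rw [← Real.log_inv, inv_div]
  rw [this, ht]
  field_simp
  ring

/-- Unless some `|X_j|` exceeds `y`, the sum equals the sum of the clipped variables, and the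
one-sided bound is applied to these and to their negatives. Clipping destroys centring, so the drift
is assumed to be at most `x / 2`. -/
theorem NegDependent.measureReal_abs_sum_gt_le {ι Ω : Type*} [MeasurableSpace Ω] {P : Measure Ω}
    [IsProbabilityMeasure P] {X : ι → Ω → ℝ} (hX : NegDependent X P) (hm : ∀ j, Measurable (X j))
    {x y B : ℝ} (hx : 0 < x) (hy : 0 < y) (hB : 0 < B) (s : Finset ι)
    (hmean : ∑ j ∈ s, |∫ ω, clip y (X j ω) ∂P| ≤ x / 2)
    (hvar : ∑ j ∈ s, ∫ ω, clip y (X j ω) ^ 2 ∂P ≤ B) :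
    P.real {ω | x < |∑ j ∈ s, X j ω|} ≤ ∑ j ∈ s, P.real {ω | y < |X j ω|} +
      2 * (Real.exp 1 * (B / y ^ 2) ^ (x / (2 * y))) := by
  have hc : ∀ j, Measurable fun ω => clip y (X j ω) := fun j => (measurable_clip y).comp (hm j)
  have h1 := measureReal_sum_gt_le (P := P) (Y := fun j ω => clip y (X j ω)) hc hx hy hB
    (fun j ω => abs_clip_le hy.le _) s (fun t ht => hX.lintegral_exp_clip_le hm y ht s)
    ((Finset.sum_le_sum fun j _ => le_abs_self _).trans hmean) hvar
  have h2 := measureReal_sum_gt_le (P := P) (Y := fun j ω => -clip y (X j ω)) (fun j => (hc j).neg)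
    hx hy hB (fun j ω => by rw [abs_neg]; exact abs_clip_le hy.le _) s
    (fun t ht => hX.lintegral_exp_neg_clip_le hm y ht s)
    ((Finset.sum_le_sum fun j _ => by
      rw [integral_neg]; exact neg_le_abs _).trans hmean) (by simpa only [neg_sq] using hvar)
  have hsub : {ω | x < |∑ j ∈ s, X j ω|} ⊆ (⋃ j ∈ s, {ω | y < |X j ω|}) ∪
      ({ω | x < ∑ j ∈ s, clip y (X j ω)} ∪ {ω | x < ∑ j ∈ s, -clip y (X j ω)}) := by
    intro ω hω
    by_cases h : ∃ j ∈ s, y < |X j ω|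
    · left
      obtain ⟨j, hj, h⟩ := h
      exact Set.mem_biUnion hj h
    · push Not at h
      right
      have e : ∑ j ∈ s, clip y (X j ω) = ∑ j ∈ s, X j ω :=
        Finset.sum_congr rfl fun j hj => clip_of_abs_le (h j hj)
      simp only [Set.mem_union, Set.mem_ofPred_eq, Finset.sum_neg_distrib, e]
      exact lt_abs.1 hω
  refine (measureReal_mono hsub).trans ((measureReal_union_le _ _).trans ?_)
  have h3 := measureReal_biUnion_finset_le (μ := P) s fun j => {ω | y < |X j ω|}
  have h4 := measureReal_union_le (μ := P) {ω | x < ∑ j ∈ s, clip y (X j ω)}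
    {ω | x < ∑ j ∈ s, -clip y (X j ω)}
  linarith

/-! ### Growth of the sizes along the lattice -/

lemma card_Icc_one {d : ℕ} (n : Lattice d) : ((Finset.Icc 1 n).card : ℝ) = size n := by
  rw [Pi.card_Icc, size]
  push_cast
  refine Finset.prod_congr rfl fun i _ => ?_
  rw [PNat.card_Icc]
  simp

lemma size_sup_le {d : ℕ} (n m : Lattice d) : size (n ⊔ m) ≤ size n * size m := by
  unfold size
  rw [← Finset.prod_mul_distrib]
  refine Finset.prod_le_prod (fun i _ => (coe_pnat_pos _).le) fun i _ => ?_
  have h1 := one_le_coe_pnat (n i)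
  have h2 := one_le_coe_pnat (m i)
  rcases le_total (n i) (m i) with h | h
  · rw [Pi.sup_apply, sup_eq_right.2 h]; nlinarith
  · rw [Pi.sup_apply, sup_eq_left.2 h]; nlinarith

lemma size_rpow_le_sizePow {d : ℕ} {α : Fin d → ℝ} {a : ℝ} (hα : ∀ i, a ≤ α i) (n : Lattice d) :
    size n ^ a ≤ sizePow α n := by
  unfold size sizePow
  rw [← Real.finsetProd_rpow _ _ fun i _ => (coe_pnat_pos _).le]
  exact Finset.prod_le_prod (fun i _ => Real.rpow_nonneg (coe_pnat_pos _).le _) fun i _ =>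
    Real.rpow_le_rpow_of_exponent_le (one_le_coe_pnat _) (hα i)

lemma one_le_sizePow {d : ℕ} {α : Fin d → ℝ} (hα : ∀ i, 0 ≤ α i) (n : Lattice d) :
    1 ≤ sizePow α n := by
  have := size_rpow_le_sizePow hα n
  rwa [Real.rpow_zero] at this

lemma le_size {d : ℕ} (n : Lattice d) (i : Fin d) : ((n i : ℕ) : ℝ) ≤ size n := by
  have : ((n i : ℕ) : ℝ) ≤ ∏ j ∈ Finset.univ, ((n j : ℕ) : ℝ) := by
    rw [← Finset.mul_prod_erase _ _ (Finset.mem_univ i)]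
    exact le_mul_of_one_le_right (coe_pnat_pos _).le
      (Finset.prod_induction _ (fun x => 1 ≤ x) (fun _ _ h h' => one_le_mul_of_one_le_of_one_le h h')
        le_rfl fun j _ => one_le_coe_pnat (n j))
  exact this

lemma tendsto_size_cofinite {d : ℕ} :
    Filter.Tendsto (size : Lattice d → ℝ) Filter.cofinite Filter.atTop := by
  rw [Filter.tendsto_atTop]
  intro b
  rw [Filter.eventually_cofinite]
  refine (Set.finite_Icc (1 : Lattice d) (fun _ => ⟨⌈|b|⌉₊ + 1, by omega⟩)).subset fun n hn => ?_
  refine ⟨fun i => one_le, fun i => ?_⟩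
  have h1 : ((n i : ℕ) : ℝ) < b := (le_size n i).trans_lt (not_le.1 hn)
  have h2 : ((n i : ℕ) : ℝ) < (⌈|b|⌉₊ : ℝ) + 1 := by
    linarith [Nat.le_ceil |b|, le_abs_self b]
  have h3 : (n i : ℕ) < ⌈|b|⌉₊ + 1 := by exact_mod_cast h2
  exact h3.le

lemma tendsto_sizePow_cofinite {d : ℕ} {α : Fin d → ℝ} {a : ℝ} (ha : 0 < a) (hα : ∀ i, a ≤ α i) :
    Filter.Tendsto (sizePow α) Filter.cofinite Filter.atTop :=
  Filter.tendsto_atTop_mono (size_rpow_le_sizePow hα)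
    ((tendsto_rpow_atTop ha).comp tendsto_size_cofinite)

lemma tsum_size_rpow_neg_two_lt_top (d : ℕ) :
    ∑' n : Lattice d, ENNReal.ofReal (size n ^ (-2 : ℝ)) < ⊤ := by
  induction d with
  | zero =>
    rw [tsum_fintype, Fintype.sum_unique]
    exact ENNReal.ofReal_lt_top
  | succ d ih =>
    rw [tsum_lattice_succ]
    have e : ∀ m : ℕ+, ∑' n : Lattice d, ENNReal.ofReal (size (Fin.cons m n : Lattice (d + 1)) ^ (-2 : ℝ)) =
        ENNReal.ofReal (((m : ℕ) : ℝ) ^ (-2 : ℝ)) * ∑' n : Lattice d, ENNReal.ofReal (size n ^ (-2 : ℝ)) := by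
      intro m
      rw [← ENNReal.tsum_mul_left]
      refine tsum_congr fun n => ?_
      rw [size_cons, Real.mul_rpow (coe_pnat_pos m).le (size_pos n).le,
        ENNReal.ofReal_mul (Real.rpow_nonneg (coe_pnat_pos m).le _)]
    rw [tsum_congr e, ENNReal.tsum_mul_right]
    obtain ⟨C, _, h⟩ := tsum_pnat_rpow_const_le (δ := 1) one_pos
    refine ENNReal.mul_lt_top (lt_of_le_of_lt ?_ (h.trans_lt ENNReal.ofReal_lt_top)) ih
    norm_num

lemma summable_of_eventually_ofReal_le {ι : Type*} {f : ι → ℝ} (hf : ∀ i, 0 ≤ f i)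
    {g : ι → ENNReal} (hg : ∑' i, g i ≠ ⊤)
    (h : ∀ᶠ i in Filter.cofinite, ENNReal.ofReal (f i) ≤ g i) : Summable f := by
  refine Summable.of_norm_bounded_eventually (ENNReal.summable_toReal hg) ?_
  filter_upwards [h] with i hi
  rw [Real.norm_of_nonneg (hf i), ← ENNReal.toReal_ofReal (hf i)]
  exact ENNReal.toReal_mono (ENNReal.ne_top_of_tsum_ne_top hg i) hi

/-! ### Replacing the field by one dominating variable -/

section

variable {d : ℕ} {Ω Ω' : Type*} [MeasurableSpace Ω] [MeasurableSpace Ω']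

/-- This removes the restrictions `x > x₀` and `n ≥ n₀`. Replacing `|ξ|` by a maximum with a
constant above `x₀` makes its tail equal to `1` for `x ≤ x₀`; enlarging `n` to `n ⊔ n₀` multiplies
the size by at most `size n₀`. -/
lemma WeaklyMeanBounded.exists_dominating {P : Measure Ω} [IsProbabilityMeasure P]
    {Q : Measure Ω'} [IsProbabilityMeasure Q] {X : Lattice d → Ω → ℝ} {ξ : Ω' → ℝ}
    (h : WeaklyMeanBounded X P ξ Q) :
    ∃ K x₁ : ℝ, 1 ≤ K ∧ 1 ≤ x₁ ∧ ∀ (n : Lattice d) (x : ℝ),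
      ∑ k ∈ Finset.Icc 1 n, P {ω | x < |X k ω|} ≤
        ENNReal.ofReal (K * size n) * Q {ω | x < max |ξ ω| x₁} := by
  obtain ⟨κ₁, κ₂, hκ₁, -, n₀, x₀, hx₀, h⟩ := h
  refine ⟨max (κ₁ * size n₀) 1, x₀ + 1, le_max_right _ _, by linarith, fun n x => ?_⟩
  set K := max (κ₁ * size n₀) 1
  have hn := size_pos n
  have hK : 1 ≤ K := le_max_right _ _
  rcases le_or_gt x x₀ with hx | hx
  · have : {ω | x < max |ξ ω| (x₀ + 1)} = Set.univ := by
      ext ω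
      simp only [Set.mem_ofPred_eq, Set.mem_univ, iff_true]
      exact lt_max_of_lt_right (by linarith)
    rw [this, measure_univ, mul_one]
    calc ∑ k ∈ Finset.Icc 1 n, P {ω | x < |X k ω|} ≤ ∑ k ∈ Finset.Icc 1 n, (1 : ENNReal) :=
          Finset.sum_le_sum fun k _ => prob_le_one
      _ = ENNReal.ofReal (size n) := by
          rw [Finset.sum_const, nsmul_eq_mul, mul_one, ← card_Icc_one, ENNReal.ofReal_natCast]
      _ ≤ _ := ENNReal.ofReal_le_ofReal (by nlinarith)
  · have h1 := (h x hx (n ⊔ n₀) le_sup_right).2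
    have hs := size_pos (n ⊔ n₀)
    rw [one_div, inv_mul_le_iff₀ hs] at h1
    have h2 : ∑ k ∈ Finset.Icc 1 n, P.real {ω | x < |X k ω|} ≤
        ∑ k ∈ Finset.Icc 1 (n ⊔ n₀), P.real {ω | x < |X k ω|} :=
      Finset.sum_le_sum_of_subset_of_nonneg (Finset.Icc_subset_Icc_right le_sup_left)
        fun _ _ _ => measureReal_nonneg
    have h3 : Q.real {ω | x < |ξ ω|} ≤ Q.real {ω | x < max |ξ ω| (x₀ + 1)} :=
      measureReal_mono fun ω (hω : x < |ξ ω|) => lt_max_of_lt_left (b := |ξ ω|) hω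
    have h4 : ∑ k ∈ Finset.Icc 1 n, P.real {ω | x < |X k ω|} ≤
        K * size n * Q.real {ω | x < max |ξ ω| (x₀ + 1)} := by
      refine (h2.trans h1).trans ?_
      have hn₀ := size_pos n₀
      have h5 : size (n ⊔ n₀) * κ₁ ≤ K * size n := by
        calc size (n ⊔ n₀) * κ₁ ≤ (size n * size n₀) * κ₁ := by
              gcongr; exact size_sup_le n n₀
          _ = (κ₁ * size n₀) * size n := by ring
          _ ≤ _ := mul_le_mul_of_nonneg_right (le_max_left _ _) hn.le
      rw [← mul_assoc]
      exact mul_le_mul h5 h3 measureReal_nonneg (by positivity)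
    have h6 := ENNReal.ofReal_le_ofReal h4
    rw [ENNReal.ofReal_sum_of_nonneg fun _ _ => measureReal_nonneg,
      ENNReal.ofReal_mul (by positivity), ofReal_measureReal] at h6
    rwa [Finset.sum_congr rfl fun k _ => ofReal_measureReal (μ := P) (s := {ω | x < |X k ω|})] at h6

/-- Comparison of tails implies comparison of expectations of increasing functions. -/
lemma sum_lintegral_le_of_tails {ι : Type*} {P : Measure Ω} {Q : Measure Ω'} {s : Finset ι}
    {Y : ι → Ω → ℝ} (hY : ∀ j, Measurable (Y j)) (hY0 : ∀ j ω, 0 ≤ Y j ω) {W : Ω' → ℝ}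
    (hW : Measurable W) (hW0 : ∀ ω, 0 ≤ W ω) {M : ENNReal}
    (h : ∀ x : ℝ, ∑ j ∈ s, P {ω | x < Y j ω} ≤ M * Q {ω | x < W ω}) {φ : ℝ → ℝ}
    (hφ : Measurable φ) (hφ0 : ∀ u, 0 ≤ φ u)
    (hlev : ∀ t, 0 < t → (∃ x, ∀ u, 0 ≤ u → (t < φ u ↔ x < u)) ∨ ∀ u, 0 ≤ u → φ u ≤ t) :
    ∑ j ∈ s, ∫⁻ ω, ENNReal.ofReal (φ (Y j ω)) ∂P ≤ M * ∫⁻ ω, ENNReal.ofReal (φ (W ω)) ∂Q := by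
  have e1 : ∀ j, ∫⁻ ω, ENNReal.ofReal (φ (Y j ω)) ∂P =
      ∫⁻ t in Set.Ioi (0 : ℝ), P {ω | t < φ (Y j ω)} := fun j =>
    lintegral_eq_lintegral_meas_lt P (Filter.Eventually.of_forall fun ω => hφ0 _)
      (hφ.comp (hY j)).aemeasurable
  have e2 : ∫⁻ ω, ENNReal.ofReal (φ (W ω)) ∂Q = ∫⁻ t in Set.Ioi (0 : ℝ), Q {ω | t < φ (W ω)} :=
    lintegral_eq_lintegral_meas_lt Q (Filter.Eventually.of_forall fun ω => hφ0 _)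
      (hφ.comp hW).aemeasurable
  have hm : ∀ {Ω₁ : Type _} [MeasurableSpace Ω₁] (R : Measure Ω₁) (f : Ω₁ → ℝ),
      Measurable fun t : ℝ => R {ω | t < f ω} := fun R f =>
    Antitone.measurable fun t t' htt => measure_mono fun ω hω => lt_of_le_of_lt htt hω
  have hm' : ∀ (R : Measure Ω') (f : Ω' → ℝ),
      Measurable fun t : ℝ => R {ω | t < f ω} := fun R f =>
    Antitone.measurable fun t t' htt => measure_mono fun ω hω => lt_of_le_of_lt htt hω
  simp_rw [e1]
  rw [e2, ← lintegral_finsetSum _ fun j _ => hm P _, ← lintegral_const_mul _ (hm' Q _)]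
  refine setLIntegral_mono_ae' measurableSet_Ioi (Filter.Eventually.of_forall fun t ht => ?_)
  rcases hlev t ht with ⟨x, hx⟩ | hn
  · simp only [hx _ (hY0 _ _), hx _ (hW0 _)]
    exact h x
  · have : ∀ j, {ω | t < φ (Y j ω)} = ∅ := fun j =>
      Set.eq_empty_of_forall_notMem fun ω hω => absurd hω (not_lt.2 (hn _ (hY0 j ω)))
    simp [this]

lemma level_max_sub (y t : ℝ) (ht : 0 < t) :
    (∃ x, ∀ u, 0 ≤ u → (t < max (u - y) 0 ↔ x < u)) ∨ ∀ u : ℝ, 0 ≤ u → max (u - y) 0 ≤ t := by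
  refine Or.inl ⟨t + y, fun u _ => ?_⟩
  rw [lt_max_iff, lt_sub_iff_add_lt]
  exact or_iff_left (not_lt.2 ht.le)

lemma level_min_sq {y : ℝ} (hy : 0 < y) (t : ℝ) (ht : 0 < t) :
    (∃ x, ∀ u, 0 ≤ u → (t < (min u y) ^ 2 ↔ x < u)) ∨ ∀ u : ℝ, 0 ≤ u → (min u y) ^ 2 ≤ t := by
  rcases lt_or_ge t (y ^ 2) with h | h
  · refine Or.inl ⟨Real.sqrt t, fun u hu => ?_⟩
    rw [← Real.sqrt_lt' (show 0 < y from hy)] at h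
    rw [← Real.sqrt_lt_sqrt_iff ht.le, Real.sqrt_sq (le_min hu hy.le), lt_min_iff]
    exact and_iff_left h
  · refine Or.inr fun u hu => le_trans ?_ h
    exact pow_le_pow_left₀ (le_min hu hy.le) (min_le_right _ _) 2

lemma lintegral_tail_rpow_tendsto {Q : Measure Ω'} {η : Ω' → ℝ} (hη : Measurable η) {r : ℝ}
    (hr : ∫⁻ ω, ENNReal.ofReal (η ω ^ r) ∂Q ≠ ⊤) :
    Filter.Tendsto (fun y : ℝ => ∫⁻ ω, {ω | y < η ω}.indicator
      (fun ω => ENNReal.ofReal (η ω ^ r)) ω ∂Q) Filter.atTop (nhds 0) := by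
  have hm : Measurable fun ω => ENNReal.ofReal (η ω ^ r) := (hη.pow_const r).ennreal_ofReal
  have := tendsto_lintegral_filter_of_dominated_convergence (μ := Q) (l := Filter.atTop)
    (F := fun (y : ℝ) ω => {ω | y < η ω}.indicator (fun ω => ENNReal.ofReal (η ω ^ r)) ω)
    (f := fun _ => 0) (fun ω => ENNReal.ofReal (η ω ^ r))
    (Filter.Eventually.of_forall fun y => hm.indicator (measurableSet_lt measurable_const hη))
    (Filter.Eventually.of_forall fun y => Filter.Eventually.of_forall fun ω =>
      Set.indicator_le_self _ _ _) hr
    (Filter.Eventually.of_forall fun ω => ?_)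
  · simpa using this
  · refine tendsto_const_nhds.congr' ?_
    filter_upwards [Filter.eventually_ge_atTop (η ω)] with y hy
    rw [Set.indicator_of_notMem]
    exact not_lt.2 hy

variable {P : Measure Ω} [IsProbabilityMeasure P] {Q : Measure Ω'}
  {X : Lattice d → Ω → ℝ} {η : Ω' → ℝ} {K r a : ℝ} {α : Fin d → ℝ}

/-- As `E X = 0`, the mean of the clipped variable is at most `E (|X| - y)₊` in absolute value. Tail
comparison passes to `(η - y)₊`, and for `η > y` one has `η = η ^ (1 - r) η ^ r ≤ y ^ (1 - r) η ^ r`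
because `r ≥ 1`. -/
lemma sum_abs_integral_clip_le (hXm : ∀ n, Measurable (X n)) (hXi : ∀ n, Integrable (X n) P)
    (hX0 : ∀ n, ∫ ω, X n ω ∂P = 0) (hη : Measurable η) (hη1 : ∀ ω, 1 ≤ η ω)
    (hr : 1 ≤ r) {n : Lattice d}
    (hdom : ∀ x : ℝ, ∑ k ∈ Finset.Icc 1 n, P {ω | x < |X k ω|} ≤
      ENNReal.ofReal (K * size n) * Q {ω | x < η ω}) {y : ℝ} (hy : 0 < y) :
    ENNReal.ofReal (∑ k ∈ Finset.Icc 1 n, |∫ ω, clip y (X k ω) ∂P|) ≤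
      ENNReal.ofReal (K * size n) * (ENNReal.ofReal (y ^ (1 - r)) *
        ∫⁻ ω, {ω | y < η ω}.indicator (fun ω => ENNReal.ofReal (η ω ^ r)) ω ∂Q) := by
  have hc : ∀ k, Measurable fun ω => clip y (X k ω) := fun k => (measurable_clip y).comp (hXm k)
  have hci : ∀ k, Integrable (fun ω => clip y (X k ω)) P := fun k =>
    Integrable.of_bound (hc k).aestronglyMeasurable y
      (Filter.Eventually.of_forall fun ω => abs_clip_le hy.le _)
  have h1 : ∀ k, ENNReal.ofReal |∫ ω, clip y (X k ω) ∂P| ≤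
      ∫⁻ ω, ENNReal.ofReal (max (|X k ω| - y) 0) ∂P := by
    intro k
    have e : ∫ ω, clip y (X k ω) ∂P = ∫ ω, (clip y (X k ω) - X k ω) ∂P := by
      rw [integral_sub (hci k) (hXi k), hX0 k, sub_zero]
    rw [e, ← Real.norm_eq_abs, ofReal_norm]
    refine (enorm_integral_le_lintegral_enorm _).trans_eq (lintegral_congr fun ω => ?_)
    rw [← ofReal_norm, Real.norm_eq_abs, abs_clip_sub hy.le]
  rw [ENNReal.ofReal_sum_of_nonneg fun _ _ => abs_nonneg _]
  refine (Finset.sum_le_sum fun k _ => h1 k).trans ?_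
  refine (sum_lintegral_le_of_tails (φ := fun u => max (u - y) 0) (fun k => (hXm k).abs)
    (fun k ω => abs_nonneg _) hη (fun ω => zero_le_one.trans (hη1 ω)) hdom
    ((measurable_id.sub_const y).max measurable_const) (fun u => le_max_right _ _)
    (fun t ht => level_max_sub y t ht)).trans ?_
  refine mul_le_mul_right ?_ _
  rw [← lintegral_const_mul _ ((hη.pow_const r).ennreal_ofReal.indicator
    (measurableSet_lt measurable_const hη))]
  refine lintegral_mono fun ω => ?_
  by_cases h : y < η ω
  · rw [Set.indicator_of_mem (show ω ∈ {ω | y < η ω} from h), ← ENNReal.ofReal_mul (by positivity)]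
    refine ENNReal.ofReal_le_ofReal ?_
    have hη0 : 0 < η ω := zero_lt_one.trans_le (hη1 ω)
    have h2 : η ω = η ω ^ (1 - r) * η ω ^ r := by
      rw [← Real.rpow_add hη0, sub_add_cancel, Real.rpow_one]
    have h3 : η ω ^ (1 - r) ≤ y ^ (1 - r) := Real.rpow_le_rpow_of_nonpos hy h.le (by linarith)
    have h4 := mul_le_mul_of_nonneg_right h3 (show 0 ≤ η ω ^ r by positivity)
    exact max_le (by linarith) (by positivity)
  · rw [max_eq_right (by linarith), ENNReal.ofReal_zero]
    exact zero_le

/-- The Fuk–Nagaev bound for the partial sums of a weakly dominated field. -/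
lemma eventually_tail_le (hX : NegDependent X P) (hXm : ∀ n, Measurable (X n))
    (hXi : ∀ n, Integrable (X n) P) (hX0 : ∀ n, ∫ ω, X n ω ∂P = 0) (hη : Measurable η)
    (hη1 : ∀ ω, 1 ≤ η ω) (hK : 1 ≤ K)
    (hdom : ∀ (n : Lattice d) (x : ℝ), ∑ k ∈ Finset.Icc 1 n, P {ω | x < |X k ω|} ≤
      ENNReal.ofReal (K * size n) * Q {ω | x < η ω})
    (ha : 0 < a) (hα : ∀ i, a ≤ α i) (hr : 1 ≤ r) (har : 1 ≤ a * r)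
    (hηr : ∫⁻ ω, ENNReal.ofReal (η ω ^ r) ∂Q ≠ ⊤) {N ε : ℝ} (hN : 0 < N) (hε : 0 < ε) :
    ∀ᶠ n in Filter.cofinite, ∀ V : ℝ, 0 < V →
      ∫⁻ ω, ENNReal.ofReal ((min (η ω) (sizePow α n * ε / N)) ^ 2) ∂Q ≤ ENNReal.ofReal V →
      ENNReal.ofReal (P.real {ω | sizePow α n * ε < |partialSum X n ω|}) ≤
        ENNReal.ofReal (K * size n) * Q {ω | sizePow α n * ε / N < η ω} +
        ENNReal.ofReal (2 * (Real.exp 1 *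
          (K * size n * V / (sizePow α n * ε / N) ^ 2) ^ (N / 2))) := by
  have hm := tendsto_sizePow_cofinite ha hα
  have hy_tend : Filter.Tendsto (fun n => sizePow α n * ε / N) Filter.cofinite Filter.atTop :=
    (hm.atTop_mul_const hε).atTop_div_const hN
  have hψ := (lintegral_tail_rpow_tendsto hη hηr).comp hy_tend
  -- Chosen so that `K m ^ r (m ε / N) ^ (1 - r) δ = m ε / 2` for `m = |n^α|`, the drift allowed by
  -- the Fuk–Nagaev bound.
  set δ : ℝ := ε / 2 / (K * (ε / N) ^ (1 - r)) with hδ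
  have hδ0 : 0 < δ := by positivity
  -- Only the drift condition determines the exceptional finite set, so `V` may depend on `n`.
  have hev := hψ.eventually (ge_mem_nhds (ENNReal.ofReal_pos.2 hδ0))
  filter_upwards [hev] with n hn V hV hvar
  have hm0 := sizePow_pos α n
  have hs0 := size_pos n
  set m := sizePow α n with hmdef
  set y := m * ε / N with hy
  have hy0 : 0 < y := by positivity
  have hx0 : 0 < m * ε := by positivity
  have hmr : size n ≤ m ^ r := by
    calc size n = size n ^ (1 : ℝ) := (Real.rpow_one _).symm
      _ ≤ size n ^ (a * r) := Real.rpow_le_rpow_of_exponent_le (one_le_size n) har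
      _ = (size n ^ a) ^ r := Real.rpow_mul hs0.le _ _
      _ ≤ m ^ r := Real.rpow_le_rpow (by positivity) (size_rpow_le_sizePow hα n) (by linarith)
  have hmean : ∑ k ∈ Finset.Icc 1 n, |∫ ω, clip y (X k ω) ∂P| ≤ m * ε / 2 := by
    have h1 := sum_abs_integral_clip_le hXm hXi hX0 hη hη1 hr (hdom n) hy0
    have h2 : ENNReal.ofReal (∑ k ∈ Finset.Icc 1 n, |∫ ω, clip y (X k ω) ∂P|) ≤
        ENNReal.ofReal (K * size n * (y ^ (1 - r) * δ)) := by
      rw [ENNReal.ofReal_mul (p := K * size n) (by positivity),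
        ENNReal.ofReal_mul (p := y ^ (1 - r)) (by positivity)]
      exact h1.trans (mul_le_mul_right (mul_le_mul_right hn _) _)
    rw [ENNReal.ofReal_le_ofReal_iff (by positivity)] at h2
    refine h2.trans ?_
    have e1 : y ^ (1 - r) = m ^ (1 - r) * (ε / N) ^ (1 - r) := by
      rw [hy, mul_div_assoc, Real.mul_rpow hm0.le (by positivity)]
    have e2 : m ^ r * m ^ (1 - r) = m := by
      rw [← Real.rpow_add hm0, add_sub_cancel, Real.rpow_one]
    have hT : 0 < (ε / N) ^ (1 - r) := by positivity
    rw [e1, hδ]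
    calc K * size n * (m ^ (1 - r) * (ε / N) ^ (1 - r) * (ε / 2 / (K * (ε / N) ^ (1 - r))))
        ≤ K * m ^ r * (m ^ (1 - r) * (ε / N) ^ (1 - r) * (ε / 2 / (K * (ε / N) ^ (1 - r)))) := by
          gcongr
      _ = (m ^ r * m ^ (1 - r)) * (ε / 2) := by field_simp
      _ = m * ε / 2 := by rw [e2]; ring
  have hvar' : ∑ k ∈ Finset.Icc 1 n, ∫ ω, clip y (X k ω) ^ 2 ∂P ≤ K * size n * V := by
    rw [← ENNReal.ofReal_le_ofReal_iff (by positivity),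
      ENNReal.ofReal_sum_of_nonneg fun _ _ => integral_nonneg fun _ => sq_nonneg _,
      ENNReal.ofReal_mul (by positivity)]
    refine le_trans ?_ (mul_le_mul_right hvar _)
    refine le_trans (le_of_eq (Finset.sum_congr rfl fun k _ => ?_))
      (sum_lintegral_le_of_tails (φ := fun u => (min u y) ^ 2) (fun k => (hXm k).abs)
        (fun k ω => abs_nonneg _) hη (fun ω => zero_le_one.trans (hη1 ω)) (hdom n)
        ((measurable_id.min measurable_const).pow_const 2) (fun u => sq_nonneg _)
        (fun t ht => level_min_sq hy0 t ht))
    rw [ofReal_integral_eq_lintegral_ofReal _ (Filter.Eventually.of_forall fun _ => sq_nonneg _)]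
    · refine lintegral_congr fun ω => ?_
      rw [← abs_clip hy0.le, sq_abs]
    · refine Integrable.of_bound
        ((((measurable_clip y).comp (hXm k)).pow_const 2).aestronglyMeasurable) (y ^ 2)
        (Filter.Eventually.of_forall fun ω => ?_)
      rw [Real.norm_eq_abs, abs_pow]
      exact pow_le_pow_left₀ (abs_nonneg _) (abs_clip_le hy0.le _) 2
  have key := hX.measureReal_abs_sum_gt_le hXm hx0 hy0 (B := K * size n * V) (by positivity)
    (Finset.Icc 1 n) hmean hvar'
  have hexp : m * ε / (2 * y) = N / 2 := by rw [hy]; field_simp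
  rw [hexp] at key
  refine (ENNReal.ofReal_le_ofReal key).trans ?_
  rw [ENNReal.ofReal_add (Finset.sum_nonneg fun _ _ => measureReal_nonneg) (by positivity),
    ENNReal.ofReal_sum_of_nonneg fun _ _ => measureReal_nonneg]
  rw [Finset.sum_congr rfl fun k _ => ofReal_measureReal (μ := P) (s := {ω | y < |X k ω|})]
  exact add_le_add_left (hdom n y) _

end

/-- Domination of the envelope of `c * max u x₁` by `1 + u ^ r * (log⁺ u) ^ j`. -/
lemma envelope_max_le {q r : ℝ} (hq : 0 ≤ q) (hr : 0 < r) (j : ℕ) {c x₁ : ℝ} (hc : 0 < c)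
    (hx₁ : 1 ≤ x₁) :
    ∃ C : ℝ, 0 < C ∧ ∀ u : ℝ, 0 ≤ u →
      envelope q r j (c * max u x₁) ≤ C * (1 + u ^ r * Real.posLog u ^ j) := by
  have henv : ∀ z : ℝ, 0 < z → envelope q r j z ≤ 1 + z ^ r * (1 + Real.posLog z) ^ j := by
    intro z hz
    have h0 : 0 ≤ z ^ r * (1 + Real.posLog z) ^ j := by
      have := Real.posLog_nonneg (x := z)
      positivity
    unfold envelope
    split_ifs with h
    · have := Real.rpow_le_one hz.le h hq
      linarith
    · rw [Real.posLog_eq_log (by rw [abs_of_pos hz]; exact (not_le.1 h).le)]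
      linarith [h0]
  -- Beyond `U` the maximum is `u` itself and `log u ≥ 1`, so additive constants are absorbed into
  -- multiples of `log u`.
  set U := max x₁ (Real.exp 1) with hU
  have hU0 : 0 < U := by positivity
  have hpc := Real.posLog_nonneg (x := c)
  have hpU := Real.posLog_nonneg (x := c * U)
  refine ⟨(1 + (c * U) ^ r * (1 + Real.posLog (c * U)) ^ j) + (1 + c ^ r * (2 + Real.posLog c) ^ j),
    by positivity, fun u hu => ?_⟩
  have hu1 := Real.posLog_nonneg (x := u)
  have hw : 0 ≤ u ^ r * Real.posLog u ^ j := by positivity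
  have hA : 0 ≤ (c * U) ^ r * (1 + Real.posLog (c * U)) ^ j := by positivity
  have hB : 0 ≤ c ^ r * (2 + Real.posLog c) ^ j := by positivity
  have hmx : 0 < max u x₁ := lt_max_of_lt_right (by linarith)
  have h1 := henv (c * max u x₁) (by positivity)
  rcases le_or_gt u U with h | h
  · have hle : c * max u x₁ ≤ c * U := by
      gcongr
      exact max_le h (le_max_left _ _)
    have hpl : Real.posLog (c * max u x₁) ≤ Real.posLog (c * U) :=
      Real.posLog_le_posLog (by positivity) hle
    have hpm := Real.posLog_nonneg (x := c * max u x₁)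
    have h2 : (c * max u x₁) ^ r * (1 + Real.posLog (c * max u x₁)) ^ j ≤
        (c * U) ^ r * (1 + Real.posLog (c * U)) ^ j := by gcongr
    nlinarith [mul_nonneg hA hw, mul_nonneg hB hw]
  · have hu' : max u x₁ = u := max_eq_left ((le_max_left _ _).trans h.le)
    have hue : Real.exp 1 ≤ u := (le_max_right _ _).trans h.le
    have hlog : 1 ≤ Real.posLog u := by
      have h3 : 1 ≤ u := (Real.one_le_exp zero_le_one).trans hue
      rw [Real.posLog_eq_log (by rw [abs_of_nonneg hu]; exact h3)]
      rwa [Real.le_log_iff_exp_le (by linarith)]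
    rw [hu'] at h1 ⊢
    have h4 : 1 + Real.posLog (c * u) ≤ (2 + Real.posLog c) * Real.posLog u := by
      have := Real.posLog_mul (x := c) (y := u)
      nlinarith
    have hpm := Real.posLog_nonneg (x := c * u)
    have h5 : (c * u) ^ r * (1 + Real.posLog (c * u)) ^ j ≤
        (c ^ r * (2 + Real.posLog c) ^ j) * (u ^ r * Real.posLog u ^ j) := by
      calc (c * u) ^ r * (1 + Real.posLog (c * u)) ^ j
          ≤ (c * u) ^ r * ((2 + Real.posLog c) * Real.posLog u) ^ j := by gcongr
        _ = _ := by rw [Real.mul_rpow hc.le hu, mul_pow]; ring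
    nlinarith [mul_nonneg hA hw, mul_nonneg hB hw]

/-! ### The direct part -/

section

variable {k : ℕ} {Ω Ω' : Type*} [MeasurableSpace Ω] [MeasurableSpace Ω']

/-- The weighted sum of truncated moments is finite under the moment condition. -/
lemma tsum_lintegral_min_ne_top {Q : Measure Ω'} [IsProbabilityMeasure Q] {η : Ω' → ℝ}
    (hη : Measurable η) (hη1 : ∀ ω, 1 ≤ η ω) {q r a : ℝ} (ha : 0 < a) (har : 1 ≤ a * r)
    (hqr : r < q) {α : Fin (k + 1) → ℝ} (h0 : α 0 = a) (hα : ∀ i, a ≤ α i)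
    (henv : ∀ c : ℝ, 0 < c → ∫⁻ ω, ENNReal.ofReal (envelope q r
      (Finset.univ.filter fun i : Fin k => α i.succ = a).card (c * η ω)) ∂Q ≠ ⊤)
    {c : ℝ} (hc : 0 < c) :
    ∑' n : Lattice (k + 1), ENNReal.ofReal (size n ^ (a * r - 1)) *
      ∫⁻ ω, ENNReal.ofReal ((min 1 (c * η ω / sizePow α n)) ^ q) ∂Q ≠ ⊤ := by
  obtain ⟨C, hC, h⟩ := tsum_lattice_min_le ha har hqr α h0 hα
  have hm : ∀ n : Lattice (k + 1), Measurable fun ω =>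
      ENNReal.ofReal ((min 1 (c * η ω / sizePow α n)) ^ q) := fun n =>
    ((measurable_const.min ((hη.const_mul c).div_const _)).pow_const q).ennreal_ofReal
  simp_rw [← lintegral_const_mul _ (hm _)]
  -- Tonelli: the deterministic count is applied inside the expectation, at `z = c * η ω`.
  rw [← lintegral_tsum fun n => ((hm n).const_mul _).aemeasurable]
  refine ne_top_of_le_ne_top (ENNReal.mul_ne_top ENNReal.ofReal_ne_top (henv c hc))
    ((lintegral_mono fun ω => ?_).trans
      (lintegral_const_mul' (ENNReal.ofReal C) _ ENNReal.ofReal_ne_top).le)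
  have hη0 : 0 < η ω := zero_lt_one.trans_le (hη1 ω)
  have := h (c * η ω) (by positivity)
  rw [ENNReal.ofReal_mul hC.le] at this
  refine le_trans (le_of_eq (tsum_congr fun n => ?_)) this
  rw [ENNReal.ofReal_mul (Real.rpow_nonneg (size_pos n).le _)]

lemma measure_lt_le_lintegral_min {Q : Measure Ω'} {η : Ω' → ℝ} (hη : Measurable η) (q : ℝ) {y : ℝ}
    (hy : 0 < y) :
    Q {ω | y < η ω} ≤ ∫⁻ ω, ENNReal.ofReal ((min 1 (η ω / y)) ^ q) ∂Q := by
  rw [← lintegral_indicator_one (measurableSet_lt measurable_const hη)]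
  refine lintegral_mono fun ω => ?_
  by_cases h : y < η ω
  · rw [Set.indicator_of_mem (show ω ∈ {ω | y < η ω} from h),
      min_eq_left ((one_le_div₀ hy).2 h.le), Real.one_rpow]
    simp
  · rw [Set.indicator_of_notMem (show ω ∉ {ω | y < η ω} from h)]
    exact zero_le

variable {P : Measure Ω} [IsProbabilityMeasure P] {Q : Measure Ω'} [IsProbabilityMeasure Q]
  {X : Lattice (k + 1) → Ω → ℝ} {ξ : Ω' → ℝ} {r a : ℝ} {α : Fin (k + 1) → ℝ}

/-- The large-jump term of the Fuk–Nagaev bound is summed by Markov's inequality for `min(1, ·)^q`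
and the lattice count. The exponential term is treated according to whether `r < 2`, where `q = 2`
is admissible in the same count, or `r ≥ 2`, where second moments are finite. -/
theorem summable_of_moment (hX : NegDependent X P) (hXm : ∀ n, Measurable (X n))
    (hXi : ∀ n, Integrable (X n) P) (hX0 : ∀ n, ∫ ω, X n ω ∂P = 0) (hξ : Measurable ξ)
    (hXξ : WeaklyMeanBounded X P ξ Q) (h0 : α 0 = a) (hα : ∀ i, a ≤ α i) (ha : 1 / 2 < a)
    (hr : 1 ≤ r) (har : 1 ≤ a * r)
    (hmom : Integrable (fun ω => |ξ ω| ^ r *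
      Real.posLog |ξ ω| ^ (Finset.univ.filter fun i : Fin k => α i.succ = a).card) Q)
    {ε : ℝ} (hε : 0 < ε) :
    Summable fun n : Lattice (k + 1) => size n ^ (a * r - 2) *
      P.real {ω | sizePow α n * ε < |partialSum X n ω|} := by
  have ha0 : 0 < a := by linarith
  obtain ⟨K, x₁, hK, hx₁, hdom⟩ := hXξ.exists_dominating
  set j := (Finset.univ.filter fun i : Fin k => α i.succ = a).card with hj
  set η : Ω' → ℝ := fun ω => max |ξ ω| x₁ with hηdef
  have hη : Measurable η := hξ.abs.max measurable_const
  have hη1 : ∀ ω, 1 ≤ η ω := fun ω => hx₁.trans (le_max_right _ _)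
  have hη0 : ∀ ω, 0 < η ω := fun ω => zero_lt_one.trans_le (hη1 ω)
  have hmom' : ∀ C : ℝ, ∫⁻ ω, ENNReal.ofReal (C * (1 + |ξ ω| ^ r * Real.posLog |ξ ω| ^ j)) ∂Q ≠ ⊤ :=
    fun C => (((integrable_const (1 : ℝ)).add hmom).const_mul C).lintegral_lt_top.ne
  have henv : ∀ (q : ℝ), 0 ≤ q → ∀ i ≤ j, ∀ c : ℝ, 0 < c →
      ∫⁻ ω, ENNReal.ofReal (envelope q r i (c * η ω)) ∂Q ≠ ⊤ := by
    intro q hq i hi c hc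
    obtain ⟨C, _, h⟩ := envelope_max_le hq (by linarith : 0 < r) j hc hx₁
    refine ne_top_of_le_ne_top (hmom' C) (lintegral_mono fun ω => ENNReal.ofReal_le_ofReal ?_)
    refine le_trans ?_ (h _ (abs_nonneg _))
    have hz : 0 < c * η ω := mul_pos hc (hη0 ω)
    change envelope q r i (c * η ω) ≤ envelope q r j (c * η ω)
    unfold envelope
    split_ifs with h1
    · exact le_rfl
    · have := Real.log_nonneg (not_le.1 h1).le
      gcongr
      linarith
  -- With `q = r` and no logarithm both branches of `envelope` are `z ^ r`.
  have hηr : ∫⁻ ω, ENNReal.ofReal (η ω ^ r) ∂Q ≠ ⊤ := by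
    refine ne_top_of_le_ne_top (henv r (by linarith) 0 (Nat.zero_le _) 1 one_pos)
      (lintegral_mono fun ω => ENNReal.ofReal_le_ofReal ?_)
    rw [one_mul]
    unfold envelope
    split_ifs <;> simp
  have hfirst : ∀ q : ℝ, r < q → ∀ c : ℝ, 0 < c →
      ∑' n : Lattice (k + 1), ENNReal.ofReal (size n ^ (a * r - 1)) *
        ∫⁻ ω, ENNReal.ofReal ((min 1 (c * η ω / sizePow α n)) ^ q) ∂Q ≠ ⊤ := fun q hq c hc =>
    tsum_lintegral_min_ne_top hη hη1 ha0 har hq h0 hα (henv q (by linarith) j le_rfl) hc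
  have hf0 : ∀ n : Lattice (k + 1), 0 ≤ size n ^ (a * r - 2) *
      P.real {ω | sizePow α n * ε < |partialSum X n ω|} := fun n =>
    mul_nonneg (Real.rpow_nonneg (size_pos n).le _) measureReal_nonneg
  have hsz : ∀ n : Lattice (k + 1), size n ^ (a * r - 2) * (K * size n) = K * size n ^ (a * r - 1) := by
    intro n
    have hn := size_pos n
    rw [show a * r - 1 = a * r - 2 + 1 by ring, Real.rpow_add_one hn.ne']
    ring
  have hmain : ∀ N : ℝ, 0 < N → ∀ q : ℝ, ∀ n : Lattice (k + 1),
      ENNReal.ofReal (size n ^ (a * r - 2)) *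
        (ENNReal.ofReal (K * size n) * Q {ω | sizePow α n * ε / N < η ω}) ≤
      ENNReal.ofReal K * (ENNReal.ofReal (size n ^ (a * r - 1)) *
        ∫⁻ ω, ENNReal.ofReal ((min 1 (N / ε * η ω / sizePow α n)) ^ q) ∂Q) := by
    intro N hN q n
    have hn := size_pos n
    have hm := sizePow_pos α n
    rw [← mul_assoc, ← mul_assoc, ← ENNReal.ofReal_mul (by positivity), hsz,
      ENNReal.ofReal_mul (by positivity)]
    refine mul_le_mul_right ((measure_lt_le_lintegral_min hη q (by positivity)).trans_eq ?_) _
    refine lintegral_congr fun ω => ?_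
    congr 3
    field_simp
  rcases lt_or_ge r 2 with hr2 | hr2
  -- `N = 2` makes the exponent `N / 2` equal to `1`: the second term is then a multiple of `|n| E
  -- min(1, η / y)²`, of the same form as the first with `q = 2 > r`.
  · have htail := eventually_tail_le hX hXm hXi hX0 hη hη1 hK hdom ha0 hα hr har hηr
      (N := 2) two_pos hε
    refine summable_of_eventually_ofReal_le hf0
      (g := fun n => ENNReal.ofReal (K + 2 * Real.exp 1 * K) *
        (ENNReal.ofReal (size n ^ (a * r - 1)) *
          ∫⁻ ω, ENNReal.ofReal ((min 1 (2 / ε * η ω / sizePow α n)) ^ (2 : ℝ)) ∂Q)) ?_ ?_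
    · rw [ENNReal.tsum_mul_left]
      exact ENNReal.mul_ne_top ENNReal.ofReal_ne_top (hfirst 2 hr2 _ (by positivity))
    · filter_upwards [htail] with n hn
      have hs := size_pos n
      have hm := sizePow_pos α n
      set y := sizePow α n * ε / 2 with hy
      have hy0 : 0 < y := by positivity
      have hminm : Measurable fun ω => (min (η ω) y) ^ 2 := (hη.min measurable_const).pow_const 2
      have hint : Integrable (fun ω => (min (η ω) y) ^ 2) Q := by
        refine Integrable.of_bound hminm.aestronglyMeasurable (y ^ 2)
          (Filter.Eventually.of_forall fun ω => ?_)
        rw [Real.norm_of_nonneg (sq_nonneg _)]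
        exact pow_le_pow_left₀ (le_min (hη0 ω).le hy0.le) (min_le_right _ _) 2
      set V := ∫ ω, (min (η ω) y) ^ 2 ∂Q with hVdef
      have hVl : ENNReal.ofReal V = ∫⁻ ω, ENNReal.ofReal ((min (η ω) y) ^ 2) ∂Q :=
        ofReal_integral_eq_lintegral_ofReal hint (Filter.Eventually.of_forall fun _ => sq_nonneg _)
      have hV : 0 < V := by
        have h1 : (min 1 y) ^ 2 ≤ V := by
          have h2 : ∫ _, (min 1 y) ^ 2 ∂Q ≤ V :=
            integral_mono (integrable_const _) hint fun ω => pow_le_pow_left₀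
              (le_min zero_le_one hy0.le) (min_le_min_right _ (hη1 ω)) 2
          simpa using h2
        have h3 : 0 < min 1 y := lt_min one_pos hy0
        exact lt_of_lt_of_le (by positivity) h1
      have h1 := hn V hV hVl.ge
      rw [ENNReal.ofReal_mul (by positivity)]
      refine (mul_le_mul_right h1 _).trans ?_
      rw [mul_add, ENNReal.ofReal_add (by positivity) (by positivity), add_mul]
      refine add_le_add (hmain 2 two_pos 2 n) ?_
      rw [div_self two_ne_zero, Real.rpow_one, ← ENNReal.ofReal_mul (by positivity)]
      have e : size n ^ (a * r - 2) * (2 * (Real.exp 1 * (K * size n * V / y ^ 2))) =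
          2 * Real.exp 1 * K * (size n ^ (a * r - 1) * (V / y ^ 2)) := by
        have := hsz n
        calc _ = 2 * Real.exp 1 * (size n ^ (a * r - 2) * (K * size n)) * (V / y ^ 2) := by ring
          _ = _ := by rw [this]; ring
      rw [e, ENNReal.ofReal_mul (by positivity),
        ENNReal.ofReal_mul (p := size n ^ (a * r - 1)) (by positivity)]
      refine mul_le_mul_right (mul_le_mul_right (le_of_eq ?_) _) _
      rw [div_eq_inv_mul, ENNReal.ofReal_mul (by positivity), hVl,
        ← lintegral_const_mul _ hminm.ennreal_ofReal]
      refine lintegral_congr fun ω => ?_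
      rw [← ENNReal.ofReal_mul (by positivity), Real.rpow_two]
      congr 1
      rw [← inv_pow, ← mul_pow, ← div_eq_inv_mul, ← min_div_div_right hy0.le, div_self hy0.ne',
        min_comm]
      congr 2
      rw [hy]
      field_simp
  · -- `r ≥ 2`: the second moment is finite
    set b := 2 * a - 1 with hb
    have hb0 : 0 < b := by linarith
    -- `B / y²` is of order at most `|n| ^ (-b)`, and `(|n| ^ (-b)) ^ (N / 2) = |n| ^ (-a r)`;
    -- multiplied by the weight this leaves the summable `|n| ^ (-2)`. Here `a > 1/2` is what makes
    -- `b` positive.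
    set N := 2 * (a * r) / b with hN
    have hN0 : 0 < N := by positivity
    obtain ⟨V, hV, hV2⟩ : ∃ V : ℝ, 0 < V ∧ ∫⁻ ω, ENNReal.ofReal (η ω ^ r) ∂Q ≤ ENNReal.ofReal V :=
      ⟨(∫⁻ ω, ENNReal.ofReal (η ω ^ r) ∂Q).toReal + 1, by positivity, by
        rw [ENNReal.ofReal_add ENNReal.toReal_nonneg zero_le_one, ENNReal.ofReal_toReal hηr]
        exact le_self_add⟩
    have htail := eventually_tail_le hX hXm hXi hX0 hη hη1 hK hdom ha0 hα hr har hηr hN0 hε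
    set D := 2 * (Real.exp 1 * (K * V / (ε / N) ^ 2) ^ (N / 2)) with hD
    have hD0 : 0 < D := by positivity
    refine summable_of_eventually_ofReal_le hf0
      (g := fun n => ENNReal.ofReal K * (ENNReal.ofReal (size n ^ (a * r - 1)) *
          ∫⁻ ω, ENNReal.ofReal ((min 1 (N / ε * η ω / sizePow α n)) ^ (r + 1)) ∂Q) +
        ENNReal.ofReal D * ENNReal.ofReal (size n ^ (-2 : ℝ))) ?_ ?_
    · rw [ENNReal.tsum_add, ENNReal.tsum_mul_left, ENNReal.tsum_mul_left]
      exact ENNReal.add_ne_top.2 ⟨ENNReal.mul_ne_top ENNReal.ofReal_ne_top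
        (hfirst (r + 1) (by linarith) _ (by positivity)),
        ENNReal.mul_ne_top ENNReal.ofReal_ne_top (tsum_size_rpow_neg_two_lt_top _).ne⟩
    · filter_upwards [htail] with n hn
      have hs := size_pos n
      have hm := sizePow_pos α n
      set y := sizePow α n * ε / N with hy
      have hy0 : 0 < y := by positivity
      have h1 := hn V hV (le_trans (lintegral_mono fun ω => ENNReal.ofReal_le_ofReal (by
        calc (min (η ω) y) ^ 2 ≤ η ω ^ 2 :=
              pow_le_pow_left₀ (le_min (hη0 ω).le hy0.le) (min_le_left _ _) 2
          _ = η ω ^ (2 : ℝ) := (Real.rpow_two _).symm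
          _ ≤ η ω ^ r := Real.rpow_le_rpow_of_exponent_le (hη1 ω) hr2)) hV2)
      rw [ENNReal.ofReal_mul (by positivity)]
      refine (mul_le_mul_right h1 _).trans ?_
      rw [mul_add]
      refine add_le_add (hmain N hN0 (r + 1) n) ?_
      rw [← ENNReal.ofReal_mul (by positivity), ← ENNReal.ofReal_mul hD0.le]
      refine ENNReal.ofReal_le_ofReal ?_
      have h2 : K * size n * V / y ^ 2 ≤ K * V / (ε / N) ^ 2 * size n ^ (-b) := by
        have h3 : (size n ^ a) ^ 2 ≤ sizePow α n ^ 2 :=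
          pow_le_pow_left₀ (by positivity) (size_rpow_le_sizePow hα n) 2
        have h4 : size n ^ (-b) = size n / (size n ^ a) ^ 2 := by
          rw [← Real.rpow_natCast, ← Real.rpow_mul hs.le, eq_div_iff (by positivity),
            ← Real.rpow_add hs]
          conv_rhs => rw [← Real.rpow_one (size n)]
          congr 1
          push_cast
          rw [hb]; ring
        have h5 : K * size n * V / y ^ 2 = K * V / (ε / N) ^ 2 * (size n / sizePow α n ^ 2) := by
          rw [hy]; field_simp
        rw [h4, h5]
        gcongr
      have h3 : (K * size n * V / y ^ 2) ^ (N / 2) ≤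
          (K * V / (ε / N) ^ 2) ^ (N / 2) * size n ^ (-(a * r)) := by
        refine (Real.rpow_le_rpow (by positivity) h2 (by positivity)).trans_eq ?_
        rw [Real.mul_rpow (by positivity) (by positivity), ← Real.rpow_mul hs.le]
        congr 2
        rw [hN]; field_simp
      have h6 : size n ^ (-2 : ℝ) = size n ^ (a * r - 2) * size n ^ (-(a * r)) := by
        rw [← Real.rpow_add hs]; congr 1; ring
      rw [h6, hD]
      calc size n ^ (a * r - 2) * (2 * (Real.exp 1 * (K * size n * V / y ^ 2) ^ (N / 2)))
          ≤ size n ^ (a * r - 2) * (2 * (Real.exp 1 *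
              ((K * V / (ε / N) ^ 2) ^ (N / 2) * size n ^ (-(a * r))))) := by gcongr
        _ = _ := by ring

end

/-! ### The converse: from maximal sums to single variables -/

/-- Pinning one more coordinate `i` to `k i` subtracts the sum over the box shortened by one in
direction `i`, which obeys the same bound; each pinned coordinate thus doubles the bound. If `k i =
1`, the subtracted sum is empty. -/
lemma abs_pinned_sum_le {d : ℕ} (x : Lattice d → ℝ) {n : Lattice d} {M : ℝ}
    (h : ∀ k ≤ n, |∑ l ∈ Finset.Icc 1 k, x l| ≤ M) (s : Finset (Fin d)) :
    ∀ k ≤ n, |∑ l ∈ Finset.Icc 1 k with ∀ i ∈ s, l i = k i, x l| ≤ 2 ^ s.card * M := by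
  classical
  induction s using Finset.induction_on with
  | empty => intro k hk; simpa using h k hk
  | insert i s hi ih =>
    intro k hk
    have hM : 0 ≤ 2 ^ s.card * M := (abs_nonneg _).trans (ih k hk)
    have hsplit := Finset.sum_filter_add_sum_filter_not
      ((Finset.Icc 1 k).filter fun l => ∀ j ∈ s, l j = k j) (fun l => l i = k i) x
    rw [Finset.filter_filter, Finset.filter_filter] at hsplit
    have e1 : (Finset.Icc 1 k).filter (fun l => (∀ j ∈ s, l j = k j) ∧ l i = k i) =
        (Finset.Icc 1 k).filter fun l => ∀ j ∈ insert i s, l j = k j := by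
      refine Finset.filter_congr fun l _ => ?_
      rw [Finset.forall_mem_insert, and_comm]
    rw [e1] at hsplit
    have hrest : |∑ l ∈ Finset.Icc 1 k with (∀ j ∈ s, l j = k j) ∧ ¬ l i = k i, x l| ≤
        2 ^ s.card * M := by
      by_cases hki : k i = 1
      · rw [Finset.filter_false_of_mem, Finset.sum_empty, abs_zero]
        · exact hM
        · rintro l hl ⟨_, h2⟩
          have hl' := Finset.mem_Icc.1 hl
          exact h2 (le_antisymm (hl'.2 i) (by rw [hki]; exact hl'.1 i))
      · obtain ⟨m, hm⟩ := PNat.exists_eq_succ_of_ne_one hki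
        have hmk : m ≤ k i := by rw [hm]; exact (PNat.lt_add_right m 1).le
        have hk' : Function.update k i m ≤ k := by
          intro j
          by_cases hj : j = i
          · subst hj; simpa using hmk
          · rw [Function.update_of_ne hj]
        have := ih (Function.update k i m) (hk'.trans hk)
        convert this using 3
        ext l
        simp only [Finset.mem_filter, Finset.mem_Icc]
        have hpin : (∀ j ∈ s, l j = Function.update k i m j) ↔ ∀ j ∈ s, l j = k j := by
          refine forall₂_congr fun j hj => ?_
          rw [Function.update_of_ne (by rintro rfl; exact hi hj)]
        rw [hpin]
        constructor
        · rintro ⟨⟨h1, h2⟩, h3, h4⟩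
          refine ⟨⟨h1, fun j => ?_⟩, h3⟩
          by_cases hj : j = i
          · subst hj
            rw [Function.update_self]
            have := lt_of_le_of_ne (h2 j) h4
            rw [hm] at this
            exact PNat.lt_add_one_iff.1 this
          · rw [Function.update_of_ne hj]; exact h2 j
        · rintro ⟨⟨h1, h2⟩, h3⟩
          refine ⟨⟨h1, h2.trans hk'⟩, h3, ?_⟩
          have h5 := h2 i
          rw [Function.update_self] at h5
          intro h6
          rw [h6, hm] at h5
          exact absurd h5 (not_le.2 (PNat.lt_add_right m 1))
    have h7 := ih k hk
    rw [Finset.card_insert_of_notMem hi, pow_succ]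
    rw [← hsplit] at h7
    rw [abs_le] at h7 hrest ⊢
    constructor <;> linarith [h7.1, h7.2, hrest.1, hrest.2]

lemma abs_le_of_maxAbsPartialSum_le {d : ℕ} {Ω : Type*} (X : Lattice d → Ω → ℝ) {n : Lattice d}
    {ω : Ω} {M : ℝ} (h : maxAbsPartialSum X n ω ≤ M) {k : Lattice d} (hk : k ≤ n) :
    |X k ω| ≤ 2 ^ d * M := by
  have h1 : ∀ l ≤ n, |∑ j ∈ Finset.Icc 1 l, X j ω| ≤ M := fun l hl =>
    ((Finset.sup'_le_iff _ _).1 h) l (Finset.mem_Icc.2 ⟨fun _ => one_le, hl⟩)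
  have h2 := abs_pinned_sum_le (fun l => X l ω) h1 Finset.univ k hk
  have h3 : (Finset.Icc 1 k).filter (fun l => ∀ i ∈ Finset.univ, l i = k i) = {k} := by
    ext l
    simp only [Finset.mem_filter, Finset.mem_Icc, Finset.mem_univ, true_imp_iff,
      Finset.mem_singleton]
    exact ⟨fun h => funext h.2, fun h => ⟨⟨fun _ => one_le, h.le⟩, fun i => congrFun h i⟩⟩
  rw [h3, Finset.sum_singleton, Finset.card_univ, Fintype.card_fin] at h2
  exact h2

/-- For one sign, negative dependence bounds the probability that no variable is large by `∏ (1 -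
p_j) ≤ exp (-∑ p_j)`. The sign carrying at least half of `∑ P(|X_j| > t)` is used, whence the `1/2`.
The union has `t ≤ |X_j|` because the complement of `{-t < X_j}` is `{X_j ≤ -t}`. -/
lemma NegDependent.one_sub_exp_le {ι Ω : Type*} [MeasurableSpace Ω] {P : Measure Ω}
    [IsProbabilityMeasure P] {X : ι → Ω → ℝ} (hX : NegDependent X P) (hm : ∀ j, Measurable (X j))
    (s : Finset ι) (t : ℝ) :
    1 - Real.exp (-(1 / 2 * ∑ j ∈ s, P.real {ω | t < |X j ω|})) ≤
      P.real (⋃ j ∈ s, {ω | t ≤ |X j ω|}) := by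
  have bound : ∀ A : ι → Set Ω, (∀ j, MeasurableSet (A j)) →
      P.real (⋂ j ∈ s, (A j)ᶜ) ≤ ∏ j ∈ s, P.real (A j)ᶜ → (∀ j, A j ⊆ {ω | t ≤ |X j ω|}) →
      1 - Real.exp (-∑ j ∈ s, P.real (A j)) ≤ P.real (⋃ j ∈ s, {ω | t ≤ |X j ω|}) := by
    intro A hA h hsub
    have h1 : P.real (⋃ j ∈ s, A j) ≤ P.real (⋃ j ∈ s, {ω | t ≤ |X j ω|}) :=
      measureReal_mono (Set.iUnion₂_mono fun j _ => hsub j) (measure_ne_top P _)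
    have h2 : P.real (⋂ j ∈ s, (A j)ᶜ) = 1 - P.real (⋃ j ∈ s, A j) := by
      rw [← Set.compl_iUnion₂, probReal_compl_eq_one_sub (Finset.measurableSet_biUnion s fun j _ => hA j)]
    have h3 : ∏ j ∈ s, P.real (A j)ᶜ ≤ Real.exp (-∑ j ∈ s, P.real (A j)) := by
      rw [← Finset.sum_neg_distrib, Real.exp_sum]
      refine Finset.prod_le_prod (fun j _ => measureReal_nonneg) fun j _ => ?_
      rw [probReal_compl_eq_one_sub (hA j)]
      linarith [Real.add_one_le_exp (-P.real (A j))]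
    linarith
  have hpos := bound (fun j => {ω | t < X j ω}) (fun j => measurableSet_lt measurable_const (hm j))
    (by
      have e : ∀ j, {ω | t < X j ω}ᶜ = {ω | X j ω ≤ t} := fun j => by ext ω; simp
      simp only [e]
      exact (hX s fun _ => t).1)
    (fun j ω (h : t < X j ω) => h.le.trans (le_abs_self _))
  have hneg := bound (fun j => {ω | X j ω ≤ -t}) (fun j => measurableSet_le (hm j) measurable_const)
    (by
      have e : ∀ j, {ω | X j ω ≤ -t}ᶜ = {ω | -t < X j ω} := fun j => by ext ω; simp
      simp only [e]
      exact (hX s fun _ => -t).2)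
    (fun j ω (h : X j ω ≤ -t) => (le_neg.1 h).trans (neg_le_abs _))
  have hsum : ∑ j ∈ s, P.real {ω | t < |X j ω|} ≤
      ∑ j ∈ s, P.real {ω | t < X j ω} + ∑ j ∈ s, P.real {ω | X j ω ≤ -t} := by
    rw [← Finset.sum_add_distrib]
    refine Finset.sum_le_sum fun j _ => (measureReal_mono ?_).trans (measureReal_union_le _ _)
    intro ω (hω : t < |X j ω|)
    rcases lt_abs.1 hω with h | h
    · exact Or.inl h
    · exact Or.inr (le_neg.1 h.le)
  rcases le_total (∑ j ∈ s, P.real {ω | t < X j ω}) (∑ j ∈ s, P.real {ω | X j ω ≤ -t}) with h | h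
  · refine le_trans (sub_le_sub_left (Real.exp_le_exp.2 ?_) _) hneg
    linarith
  · refine le_trans (sub_le_sub_left (Real.exp_le_exp.2 ?_) _) hpos
    linarith

lemma half_min_le_one_sub_exp {u : ℝ} (hu : 0 ≤ u) : 1 / 2 * min 1 u ≤ 1 - Real.exp (-u) := by
  have h1 : Real.exp (-u) ≤ (1 + u)⁻¹ := by
    rw [Real.exp_neg]
    exact inv_anti₀ (by linarith) (by linarith [Real.add_one_le_exp u])
  have h2 : 1 / 2 * min 1 u ≤ 1 - (1 + u)⁻¹ := by
    have : 1 - (1 + u)⁻¹ = u / (1 + u) := by field_simp; ring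
    rw [this, le_div_iff₀ (by linarith)]
    rcases le_total u 1 with h | h
    · rw [min_eq_right h]; nlinarith
    · rw [min_eq_left h]; linarith
  linarith

/-! ### The converse: doubling boxes and recovering the moment -/

lemma size_add_self {d : ℕ} (n : Lattice d) : size (n + n) = 2 ^ d * size n := by
  simp [size, ← two_mul, Finset.prod_mul_distrib]

lemma sizePow_add_self {d : ℕ} (α : Fin d → ℝ) (n : Lattice d) :
    sizePow α (n + n) = 2 ^ (∑ i, α i) * sizePow α n := by
  unfold sizePow
  rw [Real.rpow_sum_of_pos two_pos, ← Finset.prod_mul_distrib]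
  refine Finset.prod_congr rfl fun i _ => ?_
  rw [← Real.mul_rpow two_pos.le (coe_pnat_pos _).le]
  congr 1
  simp [← two_mul]

lemma size_mono {d : ℕ} {n m : Lattice d} (h : n ≤ m) : size n ≤ size m :=
  Finset.prod_le_prod (fun _ _ => (coe_pnat_pos _).le) fun i _ => by exact_mod_cast h i

lemma sizePow_mono {d : ℕ} {α : Fin d → ℝ} (hα : ∀ i, 0 ≤ α i) {n m : Lattice d} (h : n ≤ m) :
    sizePow α n ≤ sizePow α m :=
  Finset.prod_le_prod (fun _ _ => Real.rpow_nonneg (coe_pnat_pos _).le _) fun i _ =>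
    Real.rpow_le_rpow (coe_pnat_pos _).le (by exact_mod_cast h i) (hα i)

lemma size_le_card_Icc {d : ℕ} (n : Lattice d) : size n ≤ (Finset.Icc n (n + n)).card := by
  rw [Pi.card_Icc, size]
  push_cast
  refine Finset.prod_le_prod (fun _ _ => (coe_pnat_pos _).le) fun i _ => ?_
  rw [PNat.card_Icc]
  have : (n i : ℕ) ≤ ((n + n) i : ℕ) + 1 - (n i : ℕ) := by
    rw [Pi.add_apply, PNat.add_coe]; omega
  exact_mod_cast this

open Classical in
/-- Removing the truncation `min 1` from a convergent weighted sum over the lattice. -/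
lemma summable_of_summable_min {d : ℕ} {α : Fin d → ℝ} (hα : ∀ i, 0 ≤ α i) {b κ C : ℝ}
    (hb : 1 ≤ b) (hκ : 0 < κ) (hC : 0 < C) {g : ℝ → ℝ} (hg : Antitone g) (hg0 : ∀ x, 0 ≤ g x)
    {h : Lattice d → ℝ} (hh0 : ∀ n, 0 ≤ h n) (n₀ : Lattice d)
    (hh : ∀ n, n₀ ≤ n → 1 / 2 * min 1 (κ * size n * g (C * sizePow α n)) ≤ h n)
    (hsum : Summable fun n => size n ^ (b - 2) * h n) :
    Summable fun n => if n₀ ≤ n then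
      size n ^ (b - 1) * g (C * 2 ^ (∑ i, α i) * sizePow α n) else 0 := by
  set A : ℝ := 2 ^ (∑ i, α i) with hA
  have hA1 : 1 ≤ A := Real.one_le_rpow one_le_two (Finset.sum_nonneg fun i _ => hα i)
  have hmin : ∀ n n', n₀ ≤ n → n ≤ n' → n' ≤ n + n →
      1 / 2 * min 1 (κ * size n * g (C * A * sizePow α n)) ≤ h n' := by
    intro n n' h0 h1 h2
    refine le_trans ?_ (hh n' (h0.trans h1))
    have h3 : sizePow α n' ≤ A * sizePow α n := by
      rw [hA, ← sizePow_add_self]; exact sizePow_mono hα h2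
    have h4 : g (C * A * sizePow α n) ≤ g (C * sizePow α n') := hg (by
      rw [mul_assoc]; exact mul_le_mul_of_nonneg_left h3 hC.le)
    have h5 := size_mono h1
    have h6 := size_pos n
    have h7 := hg0 (C * A * sizePow α n)
    have h8 : 0 ≤ κ * size n' := by have := size_pos n'; positivity
    gcongr
  have hf0 : ∀ n, 0 ≤ size n ^ (b - 2) * h n := fun n =>
    mul_nonneg (Real.rpow_nonneg (size_pos n).le _) (hh0 n)
  -- A box `[n, 2n]` has at least `|n|` points, each of weight at least `1 / (2^d |n|)` since `b - 2
  -- ≥ -1`. A minimum equal to `1` would give the box a sum of at least `(1 / 2^d)(1 / 2)`, which is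
  -- impossible off the finite set `s`.
  obtain ⟨s, hs⟩ := summable_iff_vanishing_norm.1 hsum (1 / 2 ^ d * (1 / 2)) (by positivity)
  -- If `n ≤ B` fails, no point above `n` lies in `s`, so only finitely many `n` are exceptional.
  obtain ⟨B, hB⟩ := s.exists_le
  refine Summable.of_norm_bounded_eventually (hsum.mul_left (2 / κ)) ?_
  rw [Filter.eventually_cofinite]
  refine (Set.finite_Icc 1 B).subset fun n hn => ?_
  refine ⟨fun _ => one_le, ?_⟩
  by_contra hnB
  refine hn ?_
  have hsz := size_pos n
  have hgn := hg0 (C * A * sizePow α n)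
  split_ifs with h0
  · have hdisj : Disjoint (Finset.Icc n (n + n)) s := by
      rw [Finset.disjoint_left]
      intro m hm hms
      exact hnB ((Finset.mem_Icc.1 hm).1.trans (hB m hms))
    have h1 := hs _ hdisj
    rw [Real.norm_of_nonneg (Finset.sum_nonneg fun n _ => hf0 n)] at h1
    set T := min 1 (κ * size n * g (C * A * sizePow α n)) with hT
    have hT0 : 0 ≤ T := le_min zero_le_one (by positivity)
    have h2 : 1 / 2 ^ d * (1 / 2) * T ≤
        ∑ m ∈ Finset.Icc n (n + n), size m ^ (b - 2) * h m := by
      have h3 : ∀ m ∈ Finset.Icc n (n + n),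
          (2 ^ d * size n)⁻¹ * (1 / 2 * T) ≤ size m ^ (b - 2) * h m := by
        intro m hm
        obtain ⟨hm1, hm2⟩ := Finset.mem_Icc.1 hm
        have hms := size_pos m
        have h4 : (2 ^ d * size n)⁻¹ ≤ size m ^ (b - 2) := by
          calc (2 ^ d * size n)⁻¹ ≤ (size m)⁻¹ := by
                refine inv_anti₀ hms ?_
                rw [← size_add_self]; exact size_mono hm2
            _ = size m ^ (-1 : ℝ) := (Real.rpow_neg_one _).symm
            _ ≤ size m ^ (b - 2) :=
                Real.rpow_le_rpow_of_exponent_le (one_le_size m) (by linarith)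
        exact mul_le_mul h4 (hmin n m h0 hm1 hm2) (by positivity) (by positivity)
      refine le_trans ?_ (Finset.sum_le_sum h3)
      rw [Finset.sum_const, nsmul_eq_mul]
      calc 1 / 2 ^ d * (1 / 2) * T = size n * ((2 ^ d * size n)⁻¹ * (1 / 2 * T)) := by
            field_simp
        _ ≤ _ := mul_le_mul_of_nonneg_right (size_le_card_Icc n) (by positivity)
    have hT1 : T < 1 := by
      by_contra hcon
      have : 0 < (1 : ℝ) / 2 ^ d * (1 / 2) := by positivity
      nlinarith
    have hTe : T = κ * size n * g (C * A * sizePow α n) := by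
      rcases min_choice 1 (κ * size n * g (C * A * sizePow α n)) with h5 | h5
      · rw [hT, h5] at hT1; exact absurd hT1 (lt_irrefl _)
      · exact h5
    have h6 := hmin n n h0 le_rfl (fun i => (PNat.lt_add_right (n i) (n i)).le)
    rw [← hT, hTe] at h6
    rw [Real.norm_of_nonneg (by positivity), show b - 1 = b - 2 + 1 by ring,
      Real.rpow_add_one hsz.ne']
    have hp : 0 < size n ^ (b - 2) := by positivity
    calc size n ^ (b - 2) * size n * g (C * A * sizePow α n)
        = 2 / κ * (size n ^ (b - 2) * (1 / 2 * (κ * size n * g (C * A * sizePow α n)))) := by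
          field_simp
      _ ≤ _ := by gcongr
  · rw [norm_zero]
    exact mul_nonneg (by positivity) (hf0 n)

lemma rpow_mul_posLog_pow_le {r : ℝ} (hr : 0 < r) (j : ℕ) {c Z C : ℝ} (hc : 0 < c) (hZ : 1 < Z)
    (hC : 1 ≤ C) :
    ∃ B D : ℝ, 0 ≤ B ∧ 0 ≤ D ∧ ∀ u : ℝ, 0 ≤ u →
      u ^ r * Real.posLog u ^ j ≤
        B + D * (if Z ≤ u / C then c * (u / C) ^ r * Real.log (u / C) ^ j else 0) := by
  -- `u ≥ C²` gives `log u ≤ 2 log (u / C)`, and `u ≥ C Z` gives `u / C ≥ Z`.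
  set U := max (C * Z) (C * C) with hU
  have hC0 : 0 < C := by linarith
  have hU0 : 0 < U := lt_max_of_lt_right (by positivity)
  have hpU := Real.posLog_nonneg (x := U)
  refine ⟨U ^ r * Real.posLog U ^ j, C ^ r * 2 ^ j / c, by positivity, by positivity,
    fun u hu => ?_⟩
  have hpu := Real.posLog_nonneg (x := u)
  rcases le_or_gt u U with h | h
  · have h1 : u ^ r * Real.posLog u ^ j ≤ U ^ r * Real.posLog U ^ j := by
      have := Real.posLog_le_posLog hu h
      gcongr
    refine h1.trans (le_add_of_nonneg_right ?_)
    split_ifs with hz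
    · have := Real.log_nonneg (hZ.le.trans hz)
      positivity
    · simp
  · have hz : Z ≤ u / C := by
      rw [le_div_iff₀ hC0, mul_comm]; exact (le_max_left _ _).trans h.le
    have hzC : C ≤ u / C := by
      rw [le_div_iff₀ hC0]; exact (le_max_right _ _).trans h.le
    rw [if_pos hz]
    set z := u / C with hzdef
    have hz0 : 0 < z := by linarith
    have huz : u = C * z := by rw [hzdef]; field_simp
    have hlz : 0 ≤ Real.log z := Real.log_nonneg (hZ.le.trans hz)
    have h1 : Real.posLog u ≤ 2 * Real.log z := by
      have hu1 : 1 ≤ u := by rw [huz]; nlinarith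
      rw [Real.posLog_eq_log (by rwa [abs_of_nonneg hu]), huz, Real.log_mul hC0.ne' hz0.ne']
      linarith [Real.log_le_log hC0 hzC]
    have h2 : u ^ r * Real.posLog u ^ j ≤ C ^ r * 2 ^ j / c * (c * z ^ r * Real.log z ^ j) := by
      calc u ^ r * Real.posLog u ^ j ≤ u ^ r * (2 * Real.log z) ^ j := by gcongr
        _ = _ := by rw [huz, Real.mul_rpow hC0.le hz0.le, mul_pow]; field_simp
    have : 0 ≤ U ^ r * Real.posLog U ^ j := by positivity
    linarith

open Classical in
-- By Tonelli the tail series is the expectation of the weighted lattice count at `z = |ξ| / C`,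
-- which the lower bound compares with `z ^ r (log z) ^ j`.
theorem integrable_of_summable_tail {k : ℕ} {Ω' : Type*} [MeasurableSpace Ω'] {Q : Measure Ω'}
    [IsProbabilityMeasure Q] {ξ : Ω' → ℝ} (hξ : Measurable ξ) {r a C : ℝ} {α : Fin (k + 1) → ℝ}
    (h0 : α 0 = a) (hα : ∀ i, a ≤ α i) (ha : 0 < a) (hr : 0 < r) (har : 1 ≤ a * r) (hC : 1 ≤ C)
    (n₀ : Lattice (k + 1))
    (h : Summable fun n : Lattice (k + 1) => if n₀ ≤ n then
      size n ^ (a * r - 1) * Q.real {ω | C * sizePow α n < |ξ ω|} else 0) :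
    Integrable (fun ω => |ξ ω| ^ r *
      Real.posLog |ξ ω| ^ (Finset.univ.filter fun i : Fin k => α i.succ = a).card) Q := by
  set j := (Finset.univ.filter fun i : Fin k => α i.succ = a).card with hj
  have hC0 : 0 < C := by linarith
  obtain ⟨c, Z, hc, hZ, hlow⟩ := le_tsum_lattice_lt ha har α h0 hα n₀
  have hnn : ∀ n : Lattice (k + 1), 0 ≤ if n₀ ≤ n then
      size n ^ (a * r - 1) * Q.real {ω | C * sizePow α n < |ξ ω|} else 0 := by
    intro n
    have := size_pos n
    split_ifs <;> positivity
  have hfin := h.tsum_ofReal_ne_top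
  have hset : ∀ n : Lattice (k + 1), MeasurableSet {ω | sizePow α n < |ξ ω| / C} := fun n =>
    measurableSet_lt measurable_const (hξ.abs.div_const C)
  have hF : ∀ n : Lattice (k + 1), Measurable fun ω => if n₀ ≤ n ∧ sizePow α n < |ξ ω| / C then
      ENNReal.ofReal (size n ^ (a * r - 1)) else 0 := by
    intro n
    by_cases hn : n₀ ≤ n
    · simp only [hn, true_and]
      exact Measurable.ite (hset n) measurable_const measurable_const
    · simp only [hn, false_and, if_false]
      exact measurable_const
  have htot : ∫⁻ ω, ∑' n : Lattice (k + 1), (if n₀ ≤ n ∧ sizePow α n < |ξ ω| / C then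
      ENNReal.ofReal (size n ^ (a * r - 1)) else 0) ∂Q ≠ ⊤ := by
    rw [lintegral_tsum fun n => (hF n).aemeasurable]
    convert hfin using 3 with n
    by_cases hn : n₀ ≤ n
    · simp only [hn, true_and, if_true]
      rw [ENNReal.ofReal_mul (Real.rpow_nonneg (size_pos n).le _), ofReal_measureReal]
      have e : {ω | C * sizePow α n < |ξ ω|} = {ω | sizePow α n < |ξ ω| / C} := by
        ext ω; simp only [Set.mem_ofPred_eq]; rw [lt_div_iff₀ hC0, mul_comm]
      rw [e, ← lintegral_indicator_one (hset n), ← lintegral_const_mul _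
        (measurable_one.indicator (hset n))]
      refine lintegral_congr fun ω => ?_
      simp [Set.indicator_apply]
    · simp [hn]
  have hG : ∫⁻ ω, ENNReal.ofReal (if Z ≤ |ξ ω| / C then
      c * (|ξ ω| / C) ^ r * Real.log (|ξ ω| / C) ^ j else 0) ∂Q ≠ ⊤ := by
    refine ne_top_of_le_ne_top htot (lintegral_mono fun ω => ?_)
    split_ifs with hz
    · exact hlow _ hz
    · simp
  obtain ⟨B, D, hB, hD, hbound⟩ := rpow_mul_posLog_pow_le hr j hc hZ hC
  have hmeas : Measurable fun ω => |ξ ω| ^ r * Real.posLog |ξ ω| ^ j :=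
    (hξ.abs.pow_const r).mul ((Real.continuous_posLog.measurable.comp hξ.abs).pow_const j)
  refine ⟨hmeas.aestronglyMeasurable, ?_⟩
  rw [hasFiniteIntegral_iff_ofReal (Filter.Eventually.of_forall fun ω => by
    have := Real.posLog_nonneg (x := |ξ ω|)
    positivity)]
  have hle : ∀ ω, ENNReal.ofReal (|ξ ω| ^ r * Real.posLog |ξ ω| ^ j) ≤ ENNReal.ofReal B +
      ENNReal.ofReal D * ENNReal.ofReal (if Z ≤ |ξ ω| / C then
        c * (|ξ ω| / C) ^ r * Real.log (|ξ ω| / C) ^ j else 0) := by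
    intro ω
    rw [← ENNReal.ofReal_mul hD]
    exact (ENNReal.ofReal_le_ofReal (hbound _ (abs_nonneg _))).trans ENNReal.ofReal_add_le
  refine (lintegral_mono hle).trans_lt ?_
  rw [lintegral_add_left measurable_const, lintegral_const, measure_univ, mul_one,
    lintegral_const_mul' _ _ ENNReal.ofReal_ne_top]
  exact ENNReal.add_lt_top.2 ⟨ENNReal.ofReal_lt_top,
    ENNReal.mul_lt_top ENNReal.ofReal_lt_top hG.lt_top⟩

theorem integrable_of_summable_max {k : ℕ} {Ω Ω' : Type*} [MeasurableSpace Ω] [MeasurableSpace Ω']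
    {P : Measure Ω} [IsProbabilityMeasure P] {Q : Measure Ω'} [IsProbabilityMeasure Q]
    {X : Lattice (k + 1) → Ω → ℝ} {ξ : Ω' → ℝ} {r a : ℝ} {α : Fin (k + 1) → ℝ}
    (hX : NegDependent X P) (hXm : ∀ n, Measurable (X n)) (hξ : Measurable ξ)
    (hXξ : WeaklyMeanBounded X P ξ Q) (h0 : α 0 = a) (hα : ∀ i, a ≤ α i) (ha : 0 < a)
    (hr : 0 < r) (har : 1 ≤ a * r)
    (h : ∀ ε : ℝ, 0 < ε → Summable fun n : Lattice (k + 1) => size n ^ (a * r - 2) *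
      P.real {ω | sizePow α n * ε < maxAbsPartialSum X n ω}) :
    Integrable (fun ω => |ξ ω| ^ r *
      Real.posLog |ξ ω| ^ (Finset.univ.filter fun i : Fin k => α i.succ = a).card) Q := by
  obtain ⟨κ₁, κ₂, -, hκ₂, n₀, x₀, hx₀, hb⟩ := hXξ
  have hα0 : ∀ i, 0 ≤ α i := fun i => ha.le.trans (hα i)
  -- As `|n^α| ≥ 1`, the level `C |n^α|` always exceeds `x₀`, where mean boundedness is available.
  set C := x₀ + 1 with hC
  have hC0 : 0 < C := by linarith
  -- With `d = k + 1`, the level `|n^α| C / 2^(k+2)` for the maximum would force `|X_j| ≤ C |n^α| /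
  -- 2`, a contradiction once some `|X_j| ≥ C |n^α|`.
  have hlow : ∀ n : Lattice (k + 1), n₀ ≤ n →
      1 / 2 * min 1 (κ₂ / 2 * size n * Q.real {ω | C * sizePow α n < |ξ ω|}) ≤
        P.real {ω | sizePow α n * (C / 2 ^ (k + 2)) < maxAbsPartialSum X n ω} := by
    intro n hn
    have hm1 := one_le_sizePow hα0 n
    have hs := size_pos n
    have hCm : x₀ < C * sizePow α n := by nlinarith
    have h1 := (hb _ hCm n hn).1
    rw [one_div, ← div_eq_inv_mul, le_div_iff₀ hs] at h1
    refine (half_min_le_one_sub_exp (by positivity)).trans ?_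
    refine le_trans ?_ ((hX.one_sub_exp_le hXm (Finset.Icc 1 n) (C * sizePow α n)).trans
      (measureReal_mono ?_))
    · refine sub_le_sub_left (Real.exp_le_exp.2 ?_) _
      linarith
    · intro ω hω
      obtain ⟨j, hj, hjω⟩ := Set.mem_iUnion₂.1 hω
      change sizePow α n * (C / 2 ^ (k + 2)) < maxAbsPartialSum X n ω
      by_contra hcon
      have h2 := abs_le_of_maxAbsPartialSum_le X (not_lt.1 hcon) (Finset.mem_Icc.1 hj).2
      have h3 : (2 : ℝ) ^ (k + 1) * (sizePow α n * (C / 2 ^ (k + 2))) = C * sizePow α n / 2 := by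
        rw [pow_succ 2 (k + 1)]; field_simp
      rw [h3] at h2
      have h4 : C * sizePow α n ≤ |X j ω| := hjω
      nlinarith
  have key := summable_of_summable_min hα0 har (half_pos hκ₂) hC0
    (g := fun x => Q.real {ω | x < |ξ ω|})
    (fun x x' hxx => measureReal_mono fun ω (hω : x' < |ξ ω|) => lt_of_le_of_lt hxx hω)
    (fun _ => measureReal_nonneg) (fun _ => measureReal_nonneg) n₀ hlow
    (h (C / 2 ^ (k + 2)) (by positivity))
  refine integrable_of_summable_tail hξ h0 hα ha hr har ?_ n₀ key
  exact one_le_mul_of_one_le_of_one_le (by linarith)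
    (Real.one_le_rpow one_le_two (Finset.sum_nonneg fun i _ => hα0 i))

/-! ### The exponent of the logarithm and the theorem -/

/-- By monotonicity the indices with the minimal exponent form an initial segment, so the largest
one, counted from `1`, equals their number; discarding index `0` gives `p - 1`. -/
lemma lastIndex_sub_one {k : ℕ} {α : Fin (k + 1) → ℝ} (hα : Monotone α) :
    lastIndex α (α 0) - 1 = (Finset.univ.filter fun i : Fin k => α i.succ = α 0).card := by
  have hcard : (Finset.univ.filter fun i : Fin (k + 1) => α i = α 0).card =
      (Finset.univ.filter fun i : Fin k => α i.succ = α 0).card + 1 := by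
    rw [Fin.card_filter_univ_succ]
    simp
  set S := Finset.univ.filter fun i : Fin (k + 1) => α i = α 0 with hS
  suffices lastIndex α (α 0) = S.card by omega
  have hne : S.Nonempty := ⟨0, by simp [hS]⟩
  have hlow : ∀ i ∈ S, ∀ j ≤ i, j ∈ S := by
    intro i hi j hj
    rw [hS, Finset.mem_filter] at hi ⊢
    exact ⟨Finset.mem_univ _, le_antisymm ((hα hj).trans_eq hi.2) (hα (Fin.zero_le j))⟩
  unfold lastIndex
  refine le_antisymm (Finset.sup_le fun i hi => ?_) ?_
  · have : Finset.Iic i ⊆ S := fun j hj => hlow i hi j (Finset.mem_Iic.1 hj)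
    simpa using Finset.card_le_card this
  · have : S ⊆ Finset.Iic (S.max' hne) := fun i hi => Finset.mem_Iic.2 (S.le_max' i hi)
    have h1 := Finset.card_le_card this
    rw [Fin.card_Iic] at h1
    exact h1.trans (Finset.le_sup (f := fun k : Fin (k + 1) => (k : ℕ) + 1) (S.max'_mem hne))

end NDField

theorem theorem2 {d : ℕ} (hd : 2 ≤ d) {Ω Ω' : Type*} [MeasurableSpace Ω] [MeasurableSpace Ω']
    (P : Measure Ω) [IsProbabilityMeasure P] (Q : Measure Ω') [IsProbabilityMeasure Q]
    (α : Fin d → ℝ) (hα : Monotone α)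
    (α₁ : ℝ) (hα₁ : α₁ = α ⟨0, by omega⟩) (hα₁_half : 1 / 2 ≤ α₁)
    (p : ℕ) (hp : p = NDField.lastIndex α α₁)
    (r : ℝ) (hr : 1 ≤ r) (hαr : 1 ≤ α₁ * r)
    (X : NDField.Lattice d → Ω → ℝ) (hX_meas : ∀ n, Measurable (X n))
    (hX_int : ∀ n, Integrable (X n) P) (hX_mean : ∀ n, ∫ ω, X n ω ∂P = 0)
    (hX_nd : NDField.NegDependent X P)
    (ξ : Ω' → ℝ) (hξ_meas : Measurable ξ) (hXξ : NDField.WeaklyMeanBounded X P ξ Q) :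
    (1 / 2 < α₁ →
      Integrable (fun ω => |ξ ω| ^ r * Real.posLog |ξ ω| ^ (p - 1)) Q →
        ∀ ε : ℝ, 0 < ε →
          Summable fun n : NDField.Lattice d =>
            NDField.size n ^ (α₁ * r - 2) *
              P.real {ω | NDField.sizePow α n * ε < |NDField.partialSum X n ω|}) ∧
    ((∀ ε : ℝ, 0 < ε →
        Summable fun n : NDField.Lattice d =>
          NDField.size n ^ (α₁ * r - 2) *
            P.real {ω | NDField.sizePow α n * ε < NDField.maxAbsPartialSum X n ω}) →
      Integrable (fun ω => |ξ ω| ^ r * Real.posLog |ξ ω| ^ (p - 1)) Q) := by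
  obtain ⟨k, rfl⟩ : ∃ k, d = k + 1 := ⟨d - 1, by omega⟩
  have h0 : α 0 = α₁ := hα₁.symm
  have hle : ∀ i, α₁ ≤ α i := fun i => h0 ▸ hα (Fin.zero_le i)
  have hp1 : p - 1 = (Finset.univ.filter fun i : Fin k => α i.succ = α₁).card := by
    rw [hp, ← h0]
    exact NDField.lastIndex_sub_one hα
  rw [hp1]
  exact ⟨fun ha hmom ε hε => NDField.summable_of_moment hX_nd hX_meas hX_int hX_mean hξ_meas hXξ h0
      hle ha hr hαr hmom hε,
    fun h => NDField.integrable_of_summable_max hX_nd hX_meas hξ_meas hXξ h0 hle (by linarith)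
      (by linarith) hαr h⟩
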